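/- **Setting.** Let $\Omega\subset\mathbb R^2$ be a bounded, simply connected polygonal domain, $T>0$, $k\in\mathbb N$, and $c_{M1}$ a real constant. Write $\|\cdot\|$ and $(\cdot,\cdot)$ for the norm and inner product of $L^2(\Omega)$, $\boldsymbol\epsilon$ for the symmetric gradient, ${\rm curl}\,\boldsymbol v=\partial_1v_2-\partial_2v_1$, $\mathbf{curl}\,\phi=(\partial_2\phi,-\partial_1\phi)$, $\mathbf{div}$ for the row-wise divergence of a tensor field, and $\boldsymbol{\mathcal V}=[H^1_0(\Omega)]^2$. *Mesh.* $\Omega_h$ is a conforming decomposition of $\Omega$ into triangles $E$ of diameter $h_E$, each star shaped with respect to a ball of radius $\rho_E$ with $h_E\le c_{M1}\rho_E$. $\mathbb P_m(\Omega_h)$ denotes the piecewise polynomials of degree $\le m$. On an edge $e\not\subset\partial\Omega$ with fixed unit normal $\boldsymbol n^e$, $[\![\boldsymbol w]\!](\boldsymbol x)=\lim_{s\to0^+}\big(\boldsymbol w(\boldsymbol x-s\boldsymbol n^e)-\boldsymbol w(\boldsymbol x+s\boldsymbol n^e)\big)$; on $e\subset\partial\Omega$ the jump is $0$. *Spaces.*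 $\Phi_h\subset H^2_0(\Omega)$, $\boldsymbol{\mathcal V}_h\subset\boldsymbol{\mathcal V}$, $\mathcal Q_h\subset L^2_0(\Omega)$ are linear subspaces such that $0\to\Phi_h\xrightarrow{\mathbf{curl}}\boldsymbol{\mathcal V}_h\xrightarrow{\rm div}\mathcal Q_h\to0$ is exact and $\boldsymbol{\mathcal V}\cap[\mathbb P_k(\Omega_h)]^2\subseteq\boldsymbol{\mathcal V}_h\subseteq[\mathbb P_{k+3}(\Omega_h)]^2$. Put $\boldsymbol{\mathcal Z}_h=\{\boldsymbol v\in\boldsymbol{\mathcal V}_h:\int_\Omega q\,{\rm div}\,\boldsymbol v=0\ \ \forall q\in\mathcal Q_h\}$. *Time.* $N\in\mathbb N$, $\tau=T/(N+1)$, $t_n=n\tau$, $I_n=(t_n,t_{n+1})$ for $0\le n\le N$; $\boldsymbol{\mathcal Z}_h^\tau$ is the space of functions of time that are, on each $I_n$, polynomials of degree $\le1$ in $t$ with values in $\boldsymbol{\mathcal Z}_h$; $\boldsymbol v^n_\pm$ are the one-sided limits at $t_n$ and $[\![\boldsymbol v]\!]_{t_n}=\boldsymbol v^n_+-\boldsymbol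 v^n_-$. *Data.* $\nu>0$; $\boldsymbol f\in[L^2(\Omega\times(0,T))]^2$ with ${\rm curl}\,\boldsymbol f\in L^2(0,T;L^2(\Omega))$; $\boldsymbol U_0\in\boldsymbol{\mathcal V}_h$; and parameters $\delta_E$ with $0\le\delta_E\le h_E^4/(\nu\gamma_E^2)$, where $\gamma_E$ is the smallest positive constant with $\|p\|_{W^2_2(E)}\le\gamma_Eh_E^{-2}\|p\|_{L^2(E)}$ for all polynomials $p$ of degree $\le k+2$. *Discrete problem.* With all forms evaluated at each time, let $$\begin{aligned}\mathcal K_{\rm stab}(\boldsymbol w_1,\boldsymbol w_2;\boldsymbol u,\boldsymbol v)=\;&\nu\int_\Omega\boldsymbol\epsilon(\boldsymbol u):\boldsymbol\epsilon(\boldsymbol v)+\int_\Omega[(\boldsymbol\nabla\boldsymbol u)\boldsymbol w_1]\cdot\boldsymbol v\\&+\sum_E\delta_E\int_E{\rm curl}\big(\boldsymbol u_t+(\boldsymbol\nabla\boldsymbol u)\boldsymbol w_1-\nu\,\mathbf{div}\,\boldsymbol\epsilon(\boldsymbol u)\big)\,{\rm curl}\big(\boldsymbol v_t+(\boldsymbol\nabla\boldsymbol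 v)\boldsymbol w_2\big)\\&+\sum_E\frac{h_E^2}2\int_{\partial E}[\![(\boldsymbol\nabla\boldsymbol u)\boldsymbol w_1]\!]\cdot[\![(\boldsymbol\nabla\boldsymbol v)\boldsymbol w_2]\!].\end{aligned}$$ A solution of the discrete problem is a $\boldsymbol U\in\boldsymbol{\mathcal Z}_h^\tau$ such that, for all $\boldsymbol V\in\boldsymbol{\mathcal Z}_h^\tau$, $$\begin{aligned}&\int_0^T(\boldsymbol U_t,\boldsymbol V)\,dt+\sum_{j=1}^N([\![\boldsymbol U]\!]_{t_j},\boldsymbol V^j_+)+(\boldsymbol U^0_+,\boldsymbol V^0_+)+\int_0^T\mathcal K_{\rm stab}(\boldsymbol U,\boldsymbol U;\boldsymbol U,\boldsymbol V)\,dt\\&\quad=\int_0^T(\boldsymbol f,\boldsymbol V)\,dt+\int_0^T\sum_E\delta_E\int_E{\rm curl}\,\boldsymbol f\;{\rm curl}\big(\boldsymbol V_t+(\boldsymbol\nabla\boldsymbol V)\boldsymbol U\big)\,dt+(\boldsymbol U_0,\boldsymbol V^0_+).\end{aligned}$$ **Statement.** There is a constant $C>0$ depending only on $\Omega$, $T$,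 $k$ and $c_{M1}$ (in particular not on the mesh, the spaces, $\tau$, $\nu$, $\delta_E$, $\boldsymbol f$, $\boldsymbol U_0$) such that every solution $\boldsymbol U$ of the discrete problem satisfies, for $n=0,\dots,N$, $$\|\boldsymbol U\|^2_{L^\infty(t_n,t_{n+1};L^2(\Omega))}\le C\Big(\|\boldsymbol U_0\|^2+\|\boldsymbol f\|^2_{L^2(0,t_{n+1};L^2(\Omega))}+\sum_{E\in\Omega_h}\delta_E\|{\rm curl}\,\boldsymbol f\|^2_{L^2(0,t_{n+1};L^2(E))}\Big).$$ -/

import Mathlib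

open MeasureTheory Filter Topology
open scoped ENNReal ContDiff

noncomputable section

namespace VortStab

/-- The Euclidean plane. -/
abbrev Pt := EuclideanSpace ℝ (Fin 2)

/-! ### Domain and Sobolev spaces -/

/-- A bounded, simply connected, polygonal domain: its boundary is a finite union of segments. -/
structure IsPolygonalDomain (Ω : Set Pt) : Prop where
  isOpen : IsOpen Ω
  isBounded : Bornology.IsBounded Ω
  isConnected : IsConnected Ω
  simplyConnected : SimplyConnectedSpace Ω
  polygonal : ∃ S : Finset (Pt × Pt), frontier Ω = ⋃ p ∈ S, segment ℝ p.1 p.2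

/-- The (classical) partial derivative `∂g/∂x_j` of a scalar function. -/
def pd (j : Fin 2) (g : Pt → ℝ) (x : Pt) : ℝ :=
  fderiv ℝ g x (EuclideanSpace.single j 1)

/-- Test functions: smooth with compact support in `Ω`. -/
structure IsTest (Ω : Set Pt) (φ : Pt → ℝ) : Prop where
  contDiff : ContDiff ℝ ∞ φ
  hasCompactSupport : HasCompactSupport φ
  tsupport_subset : tsupport φ ⊆ Ω

/-- Membership in `L²(Ω)`. -/
def MemL2 (Ω : Set Pt) (g : Pt → ℝ) : Prop := MemLp g 2 (volume.restrict Ω)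

/-- `g'` is the weak partial derivative `∂g/∂x_j` on `Ω`. -/
def HasWeakPartial (Ω : Set Pt) (j : Fin 2) (g g' : Pt → ℝ) : Prop :=
  ∀ φ : Pt → ℝ, IsTest Ω φ →
    ∫ x in Ω, g x * pd j φ x = - ∫ x in Ω, g' x * φ x

/-- `g` is the weak scalar curl `∂F₂/∂x₁ - ∂F₁/∂x₂` of the vector field `F` on `Ω`. -/
def HasWeakCurl (Ω : Set Pt) (F : Pt → Pt) (g : Pt → ℝ) : Prop :=
  ∀ φ : Pt → ℝ, IsTest Ω φ →
    ∫ x in Ω, (F x 1 * pd 0 φ x - F x 0 * pd 1 φ x) = - ∫ x in Ω, g x * φ x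

/-- Convergence of a sequence to `g` in `L²(Ω)`. -/
def TendstoL2 (Ω : Set Pt) (φ : ℕ → Pt → ℝ) (g : Pt → ℝ) : Prop :=
  Tendsto (fun n => eLpNorm (fun x => φ n x - g x) 2 (volume.restrict Ω)) atTop (𝓝 0)

/-- `g ∈ H¹₀(Ω)`: `g` and its weak gradient `G` lie in `L²(Ω)`, and `g` is the limit in `H¹(Ω)` of
test functions. -/
def MemH10 (Ω : Set Pt) (g : Pt → ℝ) : Prop :=
  MemL2 Ω g ∧ ∃ G : Fin 2 → Pt → ℝ,
    (∀ i, MemL2 Ω (G i) ∧ HasWeakPartial Ω i g (G i)) ∧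
    ∃ φ : ℕ → Pt → ℝ, (∀ n, IsTest Ω (φ n)) ∧ TendstoL2 Ω φ g ∧
      ∀ i, TendstoL2 Ω (fun n => pd i (φ n)) (G i)

/-- `g ∈ H²₀(Ω)`: `g`, its weak gradient `G` and its weak Hessian `H` lie in `L²(Ω)`, and `g` is
the limit in `H²(Ω)` of test functions. -/
def MemH20 (Ω : Set Pt) (g : Pt → ℝ) : Prop :=
  MemL2 Ω g ∧ ∃ (G : Fin 2 → Pt → ℝ) (H : Fin 2 → Fin 2 → Pt → ℝ),
    (∀ i, MemL2 Ω (G i) ∧ HasWeakPartial Ω i g (G i)) ∧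
    (∀ i j, MemL2 Ω (H i j) ∧ HasWeakPartial Ω j (G i) (H i j)) ∧
    ∃ φ : ℕ → Pt → ℝ, (∀ n, IsTest Ω (φ n)) ∧ TendstoL2 Ω φ g ∧
      (∀ i, TendstoL2 Ω (fun n => pd i (φ n)) (G i)) ∧
      ∀ i j, TendstoL2 Ω (fun n => pd j (pd i (φ n))) (H i j)

/-! ### Differential operators for piecewise smooth vector fields

They are classical derivatives; on a function in `H¹(Ω)` which is polynomial in each open mesh
element they agree almost everywhere with the weak ones. -/

/-- The divergence. -/
def divg (v : Pt → Pt) (x : Pt) : ℝ := ∑ j, pd j (fun y => v y j) x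

/-- The scalar curl `∂v₂/∂x₁ - ∂v₁/∂x₂`. -/
def curl (v : Pt → Pt) (x : Pt) : ℝ := pd 0 (fun y => v y 1) x - pd 1 (fun y => v y 0) x

/-- The entry `(i, j)` of the symmetric gradient. -/
def eps (v : Pt → Pt) (i j : Fin 2) (x : Pt) : ℝ :=
  (pd j (fun y => v y i) x + pd i (fun y => v y j) x) / 2

/-- The row-wise divergence of the symmetric gradient. -/
def divEps (v : Pt → Pt) (x : Pt) : Pt :=
  WithLp.toLp 2 (fun i => ∑ j, pd j (eps v i j) x)

/-- The convective derivative `(∇u) w`, that is the vector with entries `∑ j, ∂_j u_i w_j`. -/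
def conv (u w : Pt → Pt) (x : Pt) : Pt := fderiv ℝ u x (w x)

/-! ### Mesh -/

/-- A conforming decomposition of `Ω` into triangles: a finite simplicial complex, all of whose
maximal faces are triangles, covering the closure of `Ω`; together with a fixed unit normal vector
on each edge. Faces are given by their sets of vertices. -/
structure Mesh (Ω : Set Pt) where
  K : Geometry.SimplicialComplex ℝ Pt
  finite : K.faces.Finite
  space_eq : K.space = closure Ω
  pure : ∀ s ∈ K.faces, ∃ E ∈ K.faces, E.card = 3 ∧ s ⊆ E
  normal : Finset Pt → Pt
  norm_normal : ∀ e ∈ K.faces, e.card = 2 → ‖normal e‖ = 1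
  normal_orth : ∀ e ∈ K.faces, e.card = 2 → ∀ a ∈ e, ∀ b ∈ e, inner ℝ (normal e) (b - a) = 0

/-- The triangles of the mesh (as sets of three vertices). -/
def Mesh.cells {Ω : Set Pt} (M : Mesh Ω) : Finset (Finset Pt) :=
  M.finite.toFinset.filter (fun s => s.card = 3)

/-- The open triangle with vertex set `E`. -/
def cell (E : Finset Pt) : Set Pt := interior (convexHull ℝ (E : Set Pt))

/-- The diameter `h_E`. -/
def diamE (E : Finset Pt) : ℝ := Metric.diam (convexHull ℝ (E : Set Pt))

/-- Shape regularity with constant `c`: each triangle `E` is star shaped with respect to a ball of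
some radius `ρ` with `h_E ≤ c ρ`. -/
def Mesh.ShapeRegular {Ω : Set Pt} (M : Mesh Ω) (c : ℝ) : Prop :=
  ∀ E ∈ M.cells, ∃ (z : Pt) (ρ : ℝ), 0 < ρ ∧ diamE E ≤ c * ρ ∧
    Metric.closedBall z ρ ⊆ convexHull ℝ (E : Set Pt) ∧
    ∀ y ∈ Metric.closedBall z ρ, StarConvex ℝ y (convexHull ℝ (E : Set Pt))

/-- The function defined by a polynomial in two variables. -/
def polyFun (p : MvPolynomial (Fin 2) ℝ) (x : Pt) : ℝ := MvPolynomial.eval (fun i => x i) p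

/-- `v ∈ [ℙ_m(Ω_h)]²`: on each open triangle, `v` is a polynomial of degree at most `m`. -/
def Mesh.IsPPoly {Ω : Set Pt} (M : Mesh Ω) (m : ℕ) (v : Pt → Pt) : Prop :=
  ∀ E ∈ M.cells, ∀ i, ∃ p : MvPolynomial (Fin 2) ℝ, p.totalDegree ≤ m ∧
    ∀ x ∈ cell E, v x i = polyFun p x

/-- The jump of `w` across the edge `e` at `x`; it is zero on edges contained in `∂Ω`. -/
def Mesh.jump {Ω : Set Pt} (M : Mesh Ω) (e : Finset Pt) (w : Pt → Pt) (x : Pt) : Pt :=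
  open Classical in
  if convexHull ℝ (e : Set Pt) ⊆ frontier Ω then 0
  else limUnder (𝓝[>] (0 : ℝ)) (fun s => w (x - s • M.normal e) - w (x + s • M.normal e))

/-- The square of the `L²(E)` norm. -/
def normSqE (E : Finset Pt) (g : Pt → ℝ) : ℝ := ∫ x in cell E, g x ^ 2

/-- The square of the `W²₂(E)` norm. -/
def normSqW2E (E : Finset Pt) (g : Pt → ℝ) : ℝ :=
  normSqE E g + normSqE E (pd 0 g) + normSqE E (pd 1 g) +
    normSqE E (pd 0 (pd 0 g)) + normSqE E (pd 0 (pd 1 g)) + normSqE E (pd 1 (pd 1 g))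

/-- The smallest positive constant `γ` in the inverse estimate
`‖p‖_{W²₂(E)} ≤ γ h_E⁻² ‖p‖_{L²(E)}` for polynomials `p` of degree at most `m`. -/
def invConst (m : ℕ) (E : Finset Pt) : ℝ :=
  sInf {γ : ℝ | 0 < γ ∧ ∀ p : MvPolynomial (Fin 2) ℝ, p.totalDegree ≤ m →
    √(normSqW2E E (polyFun p)) ≤ γ * (diamE E ^ 2)⁻¹ * √(normSqE E (polyFun p))}

/-! ### Finite element spaces -/

/-- `v ∈ [H¹₀(Ω)]²`, for a field `v` identified with its continuous representative, extended by
zero. -/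
structure MemV (Ω : Set Pt) (v : Pt → Pt) : Prop where
  continuous : Continuous v
  zero_off : ∀ x, x ∉ Ω → v x = 0
  memH10 : ∀ i, MemH10 Ω (fun x => v x i)

/-- Conforming finite element spaces `Φ_h ⊂ H²₀(Ω)`, `V_h ⊂ [H¹₀(Ω)]²`, `Q_h ⊂ L²₀(Ω)` with
`V ∩ [ℙ_k(Ω_h)]² ⊆ V_h ⊆ [ℙ_{k+3}(Ω_h)]²`, which form an exact sub-complex
`0 → Φ_h → V_h → Q_h → 0` (with the maps `curl` and `div`). Exactness at `Φ_h` is automatic. -/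
structure FESpaces {Ω : Set Pt} (M : Mesh Ω) (k : ℕ) where
  Φh : Submodule ℝ (Pt → ℝ)
  Vh : Submodule ℝ (Pt → Pt)
  Qh : Submodule ℝ (Pt → ℝ)
  Φh_sub : ∀ φ ∈ Φh, MemH20 Ω φ
  Vh_sub : ∀ v ∈ Vh, MemV Ω v
  Qh_sub : ∀ q ∈ Qh, MemL2 Ω q ∧ ∫ x in Ω, q x = 0
  poly_le : ∀ v, MemV Ω v → M.IsPPoly k v → v ∈ Vh
  le_poly : ∀ v ∈ Vh, M.IsPPoly (k + 3) v
  curl_mem : ∀ φ ∈ Φh, ∃ v ∈ Vh, HasWeakPartial Ω 1 φ (fun x => v x 0) ∧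
    HasWeakPartial Ω 0 φ (fun x => - v x 1) ∧ divg v =ᵐ[volume.restrict Ω] 0
  curl_surj : ∀ v ∈ Vh, divg v =ᵐ[volume.restrict Ω] 0 → ∃ φ ∈ Φh,
    HasWeakPartial Ω 1 φ (fun x => v x 0) ∧ HasWeakPartial Ω 0 φ (fun x => - v x 1)
  div_mem : ∀ v ∈ Vh, ∃ q ∈ Qh, divg v =ᵐ[volume.restrict Ω] q
  div_surj : ∀ q ∈ Qh, ∃ v ∈ Vh, divg v =ᵐ[volume.restrict Ω] q

/-- The form `b(v, q) = ∫_Ω q div v`. -/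
def formB (Ω : Set Pt) (v : Pt → Pt) (q : Pt → ℝ) : ℝ := ∫ x in Ω, q x * divg v x

/-- The discrete kernel `Z_h`. -/
def FESpaces.Zh {Ω : Set Pt} {M : Mesh Ω} {k : ℕ} (S : FESpaces M k) : Set (Pt → Pt) :=
  {v | v ∈ S.Vh ∧ ∀ q ∈ S.Qh, formB Ω v q = 0}

/-- `ℙ₁(I^τ, Z)`: the space-time functions which, on each interval `I_n = (nτ, (n+1)τ)` with
`n ≤ N`, are affine in time with values (coefficients) in `Z`. -/
def P1 (τ : ℝ) (N : ℕ) (Z : Set (Pt → Pt)) : Set (ℝ → Pt → Pt) :=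
  {v | ∀ n ≤ N, ∃ a ∈ Z, ∃ b ∈ Z, ∀ t ∈ Set.Ioo (n * τ) ((n + 1) * τ), v t = a + t • b}

/-! ### Forms

Space-time functions are functions of the time `t` and of the point `x`, in this order. -/

/-- The `L²(Ω)` inner product of vector fields. -/
def ip (Ω : Set Pt) (u v : Pt → Pt) : ℝ := ∫ x in Ω, inner ℝ (u x) (v x)

/-- The time derivative `v_t`. -/
def dt (v : ℝ → Pt → Pt) (t : ℝ) (x : Pt) : Pt := deriv (fun s => v s x) t

/-- The form `a(u, v) = ∫_Ω ε(u) : ε(v)`. -/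
def formA (Ω : Set Pt) (u v : Pt → Pt) : ℝ := ∫ x in Ω, ∑ i, ∑ j, eps u i j x * eps v i j x

/-- The form `c(w; u, v) = ∫_Ω [(∇u) w] · v`. -/
def formC (Ω : Set Pt) (w u v : Pt → Pt) : ℝ := ip Ω (conv u w) v

/-- `curl (v_t + (∇v) w)` at time `t`. -/
def vort (w v : ℝ → Pt → Pt) (t : ℝ) (x : Pt) : ℝ :=
  curl (fun y => dt v t y + conv (v t) (w t) y) x

variable {Ω : Set Pt}

/-- The form `𝒞(w₁, w₂; u, v)` at time `t`. -/
def stabC (M : Mesh Ω) (δ : Finset Pt → ℝ) (w₁ w₂ u v : ℝ → Pt → Pt) (t : ℝ) : ℝ :=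
  ∑ E ∈ M.cells, δ E * ∫ x in cell E, vort w₁ u t x * vort w₂ v t x

/-- The form `ℒ(w₂; u, v)` at time `t`. -/
def stabL (M : Mesh Ω) (ν : ℝ) (δ : Finset Pt → ℝ) (w₂ u v : ℝ → Pt → Pt) (t : ℝ) : ℝ :=
  ∑ E ∈ M.cells, δ E * ∫ x in cell E,
    curl (fun y => -(ν • divEps (u t) y)) x * vort w₂ v t x

/-- The form `𝒥(w₁, w₂; u, v)` at time `t`; the integral over `∂E` is the sum of the integrals,
with respect to length, over the three edges `e` of `E`. -/
def stabJ (M : Mesh Ω) (w₁ w₂ u v : ℝ → Pt → Pt) (t : ℝ) : ℝ :=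
  ∑ E ∈ M.cells, diamE E ^ 2 / 2 * ∑ e ∈ E.powersetCard 2,
    ∫ x in convexHull ℝ (e : Set Pt),
      inner ℝ (M.jump e (conv (u t) (w₁ t)) x) (M.jump e (conv (v t) (w₂ t)) x)
        ∂(Measure.hausdorffMeasure 1)

/-- The form `ℱ(w₂; v)` at time `t`, where `g` is the curl of the load. -/
def stabF (M : Mesh Ω) (δ : Finset Pt → ℝ) (g : ℝ → Pt → ℝ) (w₂ v : ℝ → Pt → Pt) (t : ℝ) : ℝ :=
  ∑ E ∈ M.cells, δ E * ∫ x in cell E, g t x * vort w₂ v t x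

/-- The form `𝒦_stab(w₁, w₂; u, v)` at time `t`. -/
def Kstab (M : Mesh Ω) (ν : ℝ) (δ : Finset Pt → ℝ) (w₁ w₂ u v : ℝ → Pt → Pt) (t : ℝ) : ℝ :=
  ν * formA Ω (u t) (v t) + formC Ω (w₁ t) (u t) (v t) + stabC M δ w₁ w₂ u v t +
    stabL M ν δ w₂ u v t + stabJ M w₁ w₂ u v t

/-- The one-sided limit `v₊ⁿ` at `t_n = nτ`. -/
def limPlus (τ : ℝ) (v : ℝ → Pt → Pt) (n : ℕ) : Pt → Pt := Function.rightLim v (n * τ)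

/-- The one-sided limit `v₋ⁿ` at `t_n = nτ`. -/
def limMinus (τ : ℝ) (v : ℝ → Pt → Pt) (n : ℕ) : Pt → Pt := Function.leftLim v (n * τ)

/-- The form `𝒜_{stab,n}(w₁, w₂; v, z)`. -/
def Astab (M : Mesh Ω) (ν : ℝ) (δ : Finset Pt → ℝ) (τ : ℝ) (n : ℕ)
    (w₁ w₂ v z : ℝ → Pt → Pt) : ℝ :=
  (∫ t in Set.Ioo 0 ((n + 1) * τ), ip Ω (dt v t) (z t)) +
    ∑ j ∈ Finset.Icc 1 n, ip Ω (limPlus τ v j - limMinus τ v j) (limPlus τ z j) +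
    ip Ω (limPlus τ v 0) (limPlus τ z 0) +
    ∫ t in Set.Ioo 0 ((n + 1) * τ), Kstab M ν δ w₁ w₂ v z t

/-- The right-hand side `ℛ_{stab,n}(σ, w₂; z)`, for the load `f` with curl `g`. -/
def Rstab (M : Mesh Ω) (δ : Finset Pt → ℝ) (τ : ℝ) (n : ℕ) (f : ℝ → Pt → Pt) (g : ℝ → Pt → ℝ)
    (σ : Pt → Pt) (w₂ z : ℝ → Pt → Pt) : ℝ :=
  (∫ t in Set.Ioo 0 ((n + 1) * τ), ip Ω (f t) (z t)) +
    (∫ t in Set.Ioo 0 ((n + 1) * τ), stabF M δ g w₂ z t) +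
    ip Ω σ (limPlus τ z 0)

/-- `U` is a solution of the discrete problem: `U ∈ Z_h^τ` and
`𝒜_{stab,N}(U, U; U, V) = ℛ_{stab,N}(U₀, U; V)` for all `V ∈ Z_h^τ`. -/
def IsDiscreteSolution {M : Mesh Ω} {k : ℕ} (S : FESpaces M k) (ν : ℝ) (δ : Finset Pt → ℝ)
    (τ : ℝ) (N : ℕ) (f : ℝ → Pt → Pt) (g : ℝ → Pt → ℝ) (U₀ : Pt → Pt) (U : ℝ → Pt → Pt) : Prop :=
  U ∈ P1 τ N S.Zh ∧
    ∀ V ∈ P1 τ N S.Zh, Astab M ν δ τ N U U U V = Rstab M δ τ N f g U₀ U V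

/-- The quantity `DATA(n)`. -/
def DATA (M : Mesh Ω) (δ : Finset Pt → ℝ) (τ : ℝ) (f : ℝ → Pt → Pt) (g : ℝ → Pt → ℝ)
    (U₀ : Pt → Pt) (n : ℕ) : ℝ :=
  (∫ x in Ω, ‖U₀ x‖ ^ 2) +
    (∫ t in Set.Ioo 0 ((n + 1) * τ), ∫ x in Ω, ‖f t x‖ ^ 2) +
    ∑ E ∈ M.cells, δ E * ∫ t in Set.Ioo 0 ((n + 1) * τ), ∫ x in cell E, g t x ^ 2

/-- The norm of `v` in `L^∞(a, b; L²(Ω))`. -/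
def normLinfL2 (Ω : Set Pt) (a b : ℝ) (v : ℝ → Pt → Pt) : ℝ≥0∞ :=
  essSup (fun t => eLpNorm (v t) 2 (volume.restrict Ω)) (volume.restrict (Set.Ioo a b))

end VortStab

end

open VortStab

noncomputable section

namespace VortStab

variable {Ω : Set Pt}

/-! The estimate is an energy argument. Fields in `P1` may jump at the nodes t_m, so the solution
cut off after t_{n+1} is an admissible test field (`energy_identity`). The time derivative and the
jumps then telescope (`sum_energy`) to half the energy just before t_{n+1}, plus half the jump
energies, plus half the energy just after time 0.

The stabilised form is bounded below by `FESpaces.Kstab_coercivity`. Its convective part vanishes: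
div V_h lies in Q_h, so a member of Z_h is divergence free almost everywhere; it is also Lipschitz
with compact support, so one may integrate by parts (`formC_self_eq_zero`). The edge part is a sum
of squares. For the vorticity part put v = curl(U_t + (∇U)U), d = curl div ε(U) and g = curl f.
Completing squares absorbs the products ν d v and g v into v², at the cost of ν²d²/3 and g². Since
ε(U) has degree at most k+2 on each triangle, the inverse estimate and the bound on δ give δν‖d‖² ≤
3‖ε(U)‖², so the viscous form pays for the first cost exactly (`cell_coercivity`), and the second
belongs to the data.

No Gronwall argument is needed for the load. Let B be the largest energy at the ends of the time
intervals; it bounds the energy at all times, because ‖U(t)‖² is convex on each interval. Young's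
inequality bounds ∫(f,U) by 8T‖f‖² + B/32. Right-end energies are controlled directly, left-end
energies through the preceding right end and the jump. Hence B ≤ 8(R + B/32), where R collects the
data, and B is absorbed (`le_of_energy`).

Much of the file is about integrability. The integral of a non-integrable function is 0 by
convention, so cutting the time integrals into intervals requires each form to be integrable in
time. The delicate one is the edge form, whose jumps are defined by `limUnder`. -/

/-! ### Geometry of the mesh: null sets and rays. -/

theorem volume_convexHull_eq_zero (s : Finset Pt) (hs : s.card ≤ 2) :
    volume (convexHull ℝ (s : Set Pt)) = 0 := by
  have h : affineSpan ℝ (s : Set Pt) ≠ ⊤ := by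
    intro h
    have h1 : vectorSpan ℝ (s : Set Pt) = ⊤ := by
      rw [← direction_affineSpan, h, AffineSubspace.direction_top]
    have h2 : Module.finrank ℝ (vectorSpan ℝ (s : Set Pt)) = 2 := by
      rw [h1, finrank_top, finrank_euclideanSpace_fin]
    rcases Nat.eq_zero_or_pos s.card with h0 | h0
    · rw [Finset.card_eq_zero] at h0
      subst h0
      rw [Finset.coe_empty, vectorSpan_empty, finrank_bot] at h2
      omega
    · classical
      have := finrank_vectorSpan_image_finset_le ℝ (id : Pt → Pt) s (n := s.card - 1) (by omega)
      rw [Finset.image_id] at this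
      omega
  exact measure_mono_null (convexHull_subset_affineSpan _)
    (Measure.addHaar_affineSubspace volume _ h)

theorem volume_segment_eq_zero (a b : Pt) : volume (segment ℝ a b) = 0 := by
  classical
  have := volume_convexHull_eq_zero {a, b} Finset.card_le_two
  rwa [Finset.coe_pair, convexHull_pair] at this

theorem IsPolygonalDomain.volume_frontier (hΩ : IsPolygonalDomain Ω) :
    volume (frontier Ω) = 0 := by
  obtain ⟨S, hS⟩ := hΩ.polygonal
  rw [hS]
  exact (measure_biUnion_null_iff S.countable_toSet).2 fun p _ => volume_segment_eq_zero _ _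

theorem Mesh.mem_cells {M : Mesh Ω} {E : Finset Pt} :
    E ∈ M.cells ↔ E ∈ M.K.faces ∧ E.card = 3 := by
  simp [Mesh.cells]

theorem isOpen_cell (E : Finset Pt) : IsOpen (cell E) := isOpen_interior

theorem measurableSet_cell (E : Finset Pt) : MeasurableSet (cell E) :=
  (isOpen_cell E).measurableSet

theorem cell_subset (E : Finset Pt) : cell E ⊆ convexHull ℝ (E : Set Pt) := interior_subset

theorem isCompact_hull (E : Finset Pt) : IsCompact (convexHull ℝ (E : Set Pt)) :=
  E.finite_toSet.isCompact_convexHull ℝ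

theorem cell_ae_eq_hull (E : Finset Pt) : cell E =ᵐ[volume] convexHull ℝ (E : Set Pt) :=
  interior_ae_eq_of_null_frontier ((convex_convexHull ℝ _).addHaar_frontier volume)

theorem integral_cell_eq {F : Type*} [NormedAddCommGroup F] [NormedSpace ℝ F] (E : Finset Pt)
    (f : Pt → F) : ∫ x in cell E, f x = ∫ x in convexHull ℝ (E : Set Pt), f x :=
  setIntegral_congr_set (cell_ae_eq_hull E)

theorem Mesh.closure_eq (M : Mesh Ω) :
    closure Ω = ⋃ E ∈ M.cells, convexHull ℝ (E : Set Pt) := by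
  rw [← M.space_eq]
  apply Set.Subset.antisymm
  · intro x hx
    obtain ⟨s, hs, hxs⟩ := M.K.mem_space_iff.1 hx
    obtain ⟨E, hE, h3, hsE⟩ := M.pure s hs
    exact Set.mem_biUnion (Mesh.mem_cells.2 ⟨hE, h3⟩)
      (convexHull_mono (Finset.coe_subset.2 hsE) hxs)
  · exact Set.iUnion₂_subset fun E hE =>
      Geometry.SimplicialComplex.convexHull_subset_space (Mesh.mem_cells.1 hE).1

theorem Mesh.hull_subset (M : Mesh Ω) {E : Finset Pt} (hE : E ∈ M.cells) :
    convexHull ℝ (E : Set Pt) ⊆ closure Ω := by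
  rw [M.closure_eq]
  exact Set.subset_biUnion_of_mem (u := fun E : Finset Pt => convexHull ℝ (E : Set Pt)) hE

/-- Two distinct closed triangles of the complex meet inside the hull of at most two common
vertices, a null set; an open null set is empty. -/
theorem Mesh.disjoint_cell (M : Mesh Ω) {E E' : Finset Pt} (hE : E ∈ M.cells)
    (hE' : E' ∈ M.cells) (hne : E ≠ E') : Disjoint (cell E) (cell E') := by
  classical
  rw [Mesh.mem_cells] at hE hE'
  rw [Set.disjoint_iff_inter_eq_empty]
  have hsub : cell E ∩ cell E' ⊆ convexHull ℝ ((E ∩ E' : Finset Pt) : Set Pt) := by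
    rw [Finset.coe_inter]
    exact (Set.inter_subset_inter (cell_subset E) (cell_subset E')).trans
      (M.K.inter_subset_convexHull hE.1 hE'.1)
  have hcard : (E ∩ E').card ≤ 2 := by
    by_contra h
    have h1 : E ∩ E' = E := Finset.eq_of_subset_of_card_le Finset.inter_subset_left (by omega)
    have h2 : E ∩ E' = E' := Finset.eq_of_subset_of_card_le Finset.inter_subset_right (by omega)
    exact hne (h1.symm.trans h2)
  exact ((isOpen_cell E).inter (isOpen_cell E')).measure_eq_zero_iff volume |>.1
    (measure_mono_null hsub (volume_convexHull_eq_zero _ hcard))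

theorem Mesh.iUnion_cell_ae_eq_closure (M : Mesh Ω) :
    (⋃ E ∈ M.cells, cell E) =ᵐ[volume] closure Ω := by
  rw [M.closure_eq]
  exact Filter.EventuallyEq.countable_bUnion M.cells.countable_toSet fun E _ => cell_ae_eq_hull E

theorem Mesh.iUnion_cell_ae_eq (M : Mesh Ω) (hΩ : IsPolygonalDomain Ω) :
    (⋃ E ∈ M.cells, cell E) =ᵐ[volume] Ω :=
  M.iUnion_cell_ae_eq_closure.trans (closure_ae_eq_of_null_frontier hΩ.volume_frontier)

theorem Mesh.integral_eq_sum (M : Mesh Ω) (hΩ : IsPolygonalDomain Ω) {f : Pt → ℝ}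
    (hf : ∀ E ∈ M.cells, IntegrableOn f (cell E)) :
    ∫ x in Ω, f x = ∑ E ∈ M.cells, ∫ x in cell E, f x := by
  rw [← setIntegral_congr_set (M.iUnion_cell_ae_eq hΩ)]
  exact integral_biUnion_finset _ (fun E _ => measurableSet_cell E)
    (fun E hE E' hE' h => M.disjoint_cell hE hE' h) hf

/-- A convex set meets a line in an interval, so membership along the ray is constant for small
positive parameters. -/
theorem eventually_ray_mem_or_notMem {C : Set Pt} (hC : Convex ℝ C) (x d : Pt) :
    (∀ᶠ s in 𝓝[>] (0 : ℝ), x + s • d ∈ C) ∨ ∀ᶠ s in 𝓝[>] (0 : ℝ), x + s • d ∉ C := by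
  by_cases h : ∃ᶠ s in 𝓝[>] (0 : ℝ), x + s • d ∈ C
  · left
    obtain ⟨b, hb, hb0⟩ := (h.and_eventually self_mem_nhdsWithin).exists
    have hb0 : 0 < b := hb0
    filter_upwards [Ioo_mem_nhdsGT hb0] with s hs
    obtain ⟨a, ha, ha0, has⟩ := (h.and_eventually (Ioo_mem_nhdsGT hs.1)).exists
    have hconv : Convex ℝ {r : ℝ | x + r • d ∈ C} := by
      have := hC.affine_preimage (AffineMap.lineMap x (x + d) : ℝ →ᵃ[ℝ] Pt)
      have e : {r : ℝ | x + r • d ∈ C} = (AffineMap.lineMap x (x + d) : ℝ →ᵃ[ℝ] Pt) ⁻¹' C := by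
        ext r
        simp [AffineMap.lineMap_apply, add_comm]
      rw [e]
      exact this
    exact hconv.ordConnected.out ha hb ⟨has.le, hs.2.le⟩
  · right
    exact not_frequently.1 h

/-- There are finitely many triangles: if the ray eventually avoids each of them, it eventually
avoids their union. -/
theorem Mesh.ray_hull (M : Mesh Ω) (x d : Pt) :
    (∃ E ∈ M.cells, ∀ᶠ s in 𝓝[>] (0 : ℝ), x + s • d ∈ convexHull ℝ (E : Set Pt)) ∨
      ∀ᶠ s in 𝓝[>] (0 : ℝ), x + s • d ∉ closure Ω := by
  by_cases h : ∃ E ∈ M.cells, ∀ᶠ s in 𝓝[>] (0 : ℝ), x + s • d ∈ convexHull ℝ (E : Set Pt)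
  · exact Or.inl h
  · right
    have : ∀ᶠ s in 𝓝[>] (0 : ℝ), ∀ E ∈ M.cells, x + s • d ∉ convexHull ℝ (E : Set Pt) := by
      rw [Filter.eventually_all_finset]
      intro E hE
      exact (eventually_ray_mem_or_notMem (convex_convexHull ℝ _) x d).resolve_left (fun h' => h ⟨E, hE, h'⟩)
    filter_upwards [this] with s hs
    rw [M.closure_eq]
    simpa using hs

/-- A ray that starts in a closed triangle and does not enter its interior runs along an edge. -/
theorem ray_edge {E : Finset Pt} (hind : AffineIndependent ℝ ((↑) : E → Pt)) (h3 : E.card = 3)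
    {x d : Pt} (hs : ∀ᶠ s in 𝓝[>] (0 : ℝ), x + s • d ∈ convexHull ℝ (E : Set Pt))
    (hn : ¬ ∀ᶠ s in 𝓝[>] (0 : ℝ), x + s • d ∈ cell E) :
    ∃ e ⊆ E, e.card = 2 ∧ x ∈ convexHull ℝ (e : Set Pt) ∧
      ∃ s : ℝ, 0 < s ∧ x + s • d ∈ convexHull ℝ (e : Set Pt) := by
  classical
  have htop : affineSpan ℝ (Set.range ((↑) : E → Pt)) = ⊤ := by
    rw [hind.affineSpan_eq_top_iff_card_eq_finrank_add_one]
    simp [h3]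
  let b : AffineBasis E ℝ Pt := ⟨(↑), hind, htop⟩
  have hrange : Set.range b = (E : Set Pt) := by
    change Set.range ((↑) : E → Pt) = _
    simp
  have hcell : cell E = {y | ∀ i, 0 < b.coord i y} := by
    rw [cell, ← hrange, b.interior_convexHull]
  have hhull : convexHull ℝ (E : Set Pt) = {y | ∀ i, 0 ≤ b.coord i y} := by
    rw [← hrange, b.convexHull_eq_nonneg_coord]
  have hline : ∀ i (s : ℝ), b.coord i (x + s • d) =
      b.coord i x + s * (b.coord i).linear d := by
    intro i s
    have := (b.coord i).map_vadd x (s • d)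
    simp only [vadd_eq_add, map_smul, smul_eq_mul] at this
    rw [add_comm x, this, add_comm]
  have hx : ∀ i, 0 ≤ b.coord i x := by
    intro i
    have ht : Tendsto (fun s : ℝ => b.coord i x + s * (b.coord i).linear d) (𝓝[>] 0)
        (𝓝 (b.coord i x + 0 * (b.coord i).linear d)) :=
      (Continuous.tendsto (by fun_prop) _).mono_left nhdsWithin_le_nhds
    rw [zero_mul, add_zero] at ht
    refine ge_of_tendsto ht ?_
    filter_upwards [hs] with s hs
    rw [hhull] at hs
    rw [← hline]
    exact hs i
  have hn' := (eventually_ray_mem_or_notMem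
    ((convex_convexHull ℝ (E : Set Pt)).interior) x d).resolve_left hn
  obtain ⟨s₀, hs₀⟩ := mem_nhdsGT_iff_exists_Ioo_subset.1 (hs.and hn')
  have hs0 : (0 : ℝ) < s₀ := hs₀.1
  have hm := hs₀.2 (⟨by positivity, by linarith⟩ : s₀ / 2 ∈ Set.Ioo 0 s₀)
  have hm4 := hs₀.2 (⟨by positivity, by linarith⟩ : 3 * s₀ / 4 ∈ Set.Ioo 0 s₀)
  -- A barycentric coordinate is affine along the ray. It is nonnegative at parameters 0 and 3s₀/4
  -- and nonpositive at s₀/2 between them, hence identically zero, and the ray runs along the edge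
  -- opposite to vertex i.
  have hmi : ∃ i, b.coord i (x + (s₀ / 2) • d) ≤ 0 := by
    have := hm.2
    change _ ∉ cell E at this
    rw [hcell] at this
    simpa using this
  obtain ⟨i, hi⟩ := hmi
  have hm1 := hm.1
  have hm2 := hm4.1
  rw [hhull] at hm1 hm2
  have e1 := hm2 i
  have e2 := hx i
  rw [hline] at hi e1
  have hx0 : b.coord i x = 0 := by nlinarith
  have hd0 : s₀ * (b.coord i).linear d = 0 := by nlinarith
  have key : ∀ y, (∀ j, 0 ≤ b.coord j y) → b.coord i y = 0 →
      y ∈ convexHull ℝ ((E.erase i : Finset Pt) : Set Pt) := by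
    intro y hy hyi
    rw [← b.linear_combination_coord_eq_self y, ← Finset.add_sum_erase _ _ (Finset.mem_univ i),
      hyi, zero_smul, zero_add]
    refine (convex_convexHull ℝ _).sum_mem (fun j _ => hy j) ?_ ?_
    · have := b.sum_coord_apply_eq_one y
      rwa [← Finset.add_sum_erase _ _ (Finset.mem_univ i), hyi, zero_add] at this
    · intro j hj
      refine subset_convexHull ℝ _ ?_
      rw [Finset.mem_coe, Finset.mem_erase]
      exact ⟨fun h => (Finset.mem_erase.1 hj).1 (Subtype.ext h), j.2⟩
  refine ⟨E.erase i, Finset.erase_subset _ _, by rw [Finset.card_erase_of_mem i.2, h3],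
    key x hx hx0, s₀ / 2, by positivity, key _ hm1 ?_⟩
  rw [hline, hx0]
  linarith

theorem inner_eq_zero_of_mem_hull {e : Finset Pt} {d : Pt}
    (hd : ∀ a ∈ e, ∀ b ∈ e, inner ℝ d (b - a) = 0) {x y : Pt}
    (hx : x ∈ convexHull ℝ (e : Set Pt)) (hy : y ∈ convexHull ℝ (e : Set Pt)) :
    inner ℝ d (y - x) = 0 := by
  have key : ∀ c : ℝ, Convex ℝ {z : Pt | inner ℝ d z = c} := by
    intro c u hu v hv a b _ _ hab
    simp only [Set.mem_ofPred_eq] at hu hv ⊢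
    rw [inner_add_right, inner_smul_right, inner_smul_right, hu, hv, ← add_mul, hab, one_mul]
  obtain ⟨a, ha⟩ : e.Nonempty := by
    have := convexHull_nonempty_iff.1 ⟨x, hx⟩
    simpa using this
  have h1 : convexHull ℝ (e : Set Pt) ⊆ {z : Pt | inner ℝ d z = inner ℝ d a} :=
    convexHull_min (fun b hb => by
      have := hd a ha b hb
      rw [inner_sub_right, sub_eq_zero] at this
      exact this) (key _)
  rw [inner_sub_right, h1 hx, h1 hy, sub_self]

/-- From a point of an edge that is not a vertex, a ray orthogonal to the edge enters an open
triangle or leaves the closed domain. -/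
theorem Mesh.ray_cell (M : Mesh Ω) {e : Finset Pt} (he : e ∈ M.K.faces) (h2 : e.card = 2)
    {d : Pt} (hd0 : d ≠ 0) (hd : ∀ a ∈ e, ∀ b ∈ e, inner ℝ d (b - a) = 0) {x : Pt}
    (hx : x ∈ convexHull ℝ (e : Set Pt)) (hxe : x ∉ e) :
    (∃ E ∈ M.cells, ∀ᶠ s in 𝓝[>] (0 : ℝ), x + s • d ∈ cell E) ∨
      ∀ᶠ s in 𝓝[>] (0 : ℝ), x + s • d ∉ closure Ω := by
  classical
  rcases M.ray_hull x d with ⟨E, hE, hEs⟩ | h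
  · left
    refine ⟨E, hE, ?_⟩
    by_contra hn
    rw [Mesh.mem_cells] at hE
    obtain ⟨e', he', h2', hx', s, hs, hxs⟩ := ray_edge (M.K.indep hE.1) hE.2 hEs hn
    have hface : e' ∈ M.K.faces :=
      M.K.down_closed hE.1 he' (Finset.card_pos.1 (by omega))
    have hmem := M.K.inter_subset_convexHull he hface ⟨hx, hx'⟩
    rw [← Finset.coe_inter] at hmem
    -- The point x lies in the hull of the common vertices of e and e'. If the edges coincide, the
    -- ray runs along e, against orthogonality; otherwise x is a vertex of e, which is excluded.
    by_cases hcard : (e ∩ e').card = 2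
    · have e1 : e ∩ e' = e := Finset.eq_of_subset_of_card_le Finset.inter_subset_left (by omega)
      have e2 : e ∩ e' = e' := Finset.eq_of_subset_of_card_le Finset.inter_subset_right (by omega)
      rw [← e2, e1] at hxs
      have := inner_eq_zero_of_mem_hull hd hx hxs
      rw [add_sub_cancel_left, inner_smul_right, real_inner_self_eq_norm_sq] at this
      have : ‖d‖ ≠ 0 := norm_ne_zero_iff.2 hd0
      simp_all [hs.ne']
    · have hle : (e ∩ e').card ≤ 1 := by
        have := Finset.card_le_card (Finset.inter_subset_left : e ∩ e' ⊆ e)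
        omega
      obtain ⟨v, hv⟩ := Finset.card_le_one_iff_subset_singleton.1 hle
      have hxv : x ∈ convexHull ℝ ({v} : Set Pt) := by
        refine convexHull_mono ?_ hmem
        rw [← Finset.coe_singleton]
        exact Finset.coe_subset.2 hv
      rw [convexHull_singleton, Set.mem_singleton_iff] at hxv
      have hne : (e ∩ e').Nonempty := by
        exact Finset.coe_nonempty.1 (convexHull_nonempty_iff.1 ⟨x, hmem⟩)
      obtain ⟨w, hw⟩ := hne
      have hwv := Finset.mem_singleton.1 (hv hw)
      exact hxe (hxv ▸ hwv ▸ (Finset.mem_inter.1 hw).1)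
  · exact Or.inr h

/-! ### Polynomials -/

/-- Pairs of polynomials in two variables. -/
abbrev PolyPair := Fin 2 → MvPolynomial (Fin 2) ℝ

/-- The vector field with polynomial components. -/
def polyVec (P : PolyPair) (x : Pt) : Pt := WithLp.toLp 2 (fun i => polyFun (P i) x)

@[simp] theorem polyVec_apply (P : PolyPair) (x : Pt) (i : Fin 2) :
    polyVec P x i = polyFun (P i) x := rfl

@[simp] theorem polyFun_add (p q : MvPolynomial (Fin 2) ℝ) (x : Pt) :
    polyFun (p + q) x = polyFun p x + polyFun q x := by simp [polyFun]

@[simp] theorem polyFun_sub (p q : MvPolynomial (Fin 2) ℝ) (x : Pt) :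
    polyFun (p - q) x = polyFun p x - polyFun q x := by simp [polyFun]

@[simp] theorem polyFun_neg (p : MvPolynomial (Fin 2) ℝ) (x : Pt) :
    polyFun (-p) x = -polyFun p x := by simp [polyFun]

@[simp] theorem polyFun_mul (p q : MvPolynomial (Fin 2) ℝ) (x : Pt) :
    polyFun (p * q) x = polyFun p x * polyFun q x := by simp [polyFun]

@[simp] theorem polyFun_smul (c : ℝ) (p : MvPolynomial (Fin 2) ℝ) (x : Pt) :
    polyFun (c • p) x = c * polyFun p x := by simp [polyFun, MvPolynomial.smul_eval]

@[simp] theorem polyFun_sum {ι : Type*} (s : Finset ι) (p : ι → MvPolynomial (Fin 2) ℝ) (x : Pt) :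
    polyFun (∑ i ∈ s, p i) x = ∑ i ∈ s, polyFun (p i) x := by simp [polyFun]

theorem hasFDerivAt_coord (i : Fin 2) (x : Pt) :
    HasFDerivAt (fun y : Pt => y i) (EuclideanSpace.proj i : Pt →L[ℝ] ℝ) x :=
  (EuclideanSpace.proj i : Pt →L[ℝ] ℝ).hasFDerivAt

theorem contDiff_polyFun (p : MvPolynomial (Fin 2) ℝ) : ContDiff ℝ ∞ (polyFun p) := by
  induction p using MvPolynomial.induction_on with
  | C a =>
    have : polyFun (MvPolynomial.C a) = fun _ => a := by ext; simp [polyFun]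
    rw [this]
    exact contDiff_const
  | add p q hp hq =>
    have : polyFun (p + q) = fun y => polyFun p y + polyFun q y := by ext; simp
    rw [this]
    exact hp.add hq
  | mul_X p i hp =>
    have : polyFun (p * MvPolynomial.X i) = fun y => polyFun p y * y i := by
      ext; simp [polyFun]
    rw [this]
    exact hp.mul (EuclideanSpace.proj i : Pt →L[ℝ] ℝ).contDiff

@[fun_prop]
theorem continuous_polyFun (p : MvPolynomial (Fin 2) ℝ) : Continuous (polyFun p) :=
  (contDiff_polyFun p).continuous

@[fun_prop]
theorem differentiable_polyFun (p : MvPolynomial (Fin 2) ℝ) : Differentiable ℝ (polyFun p) :=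
  (contDiff_polyFun p).differentiable (by simp)

theorem contDiff_polyVec (P : PolyPair) : ContDiff ℝ ∞ (polyVec P) :=
  contDiff_euclidean.2 fun i => contDiff_polyFun (P i)

@[fun_prop]
theorem continuous_polyVec (P : PolyPair) : Continuous (polyVec P) :=
  (contDiff_polyVec P).continuous

theorem differentiable_polyVec (P : PolyPair) : Differentiable ℝ (polyVec P) :=
  (contDiff_polyVec P).differentiable (by simp)

/-- This turns the differential operators into algebra on `MvPolynomial`, where degrees are visible
and linearity needs no differentiability. -/
theorem pd_polyFun (j : Fin 2) (p : MvPolynomial (Fin 2) ℝ) :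
    pd j (polyFun p) = polyFun (MvPolynomial.pderiv j p) := by
  ext x
  induction p using MvPolynomial.induction_on with
  | C a =>
    have : polyFun (MvPolynomial.C a) = fun _ => a := by ext; simp [polyFun]
    simp only [pd, this]
    simp [polyFun]
  | add p q hp hq =>
    have : polyFun (p + q) = fun y => polyFun p y + polyFun q y := by ext; simp
    rw [map_add, polyFun_add, ← hp, ← hq]
    simp only [pd, this]
    rw [fderiv_fun_add (by fun_prop) (by fun_prop)]
    rfl
  | mul_X p i hp =>
    have h1 : polyFun (p * MvPolynomial.X i) = fun y => polyFun p y * y i := by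
      ext; simp [polyFun]
    have h2 : HasFDerivAt (polyFun p) (fderiv ℝ (polyFun p) x) x :=
      (differentiable_polyFun p x).hasFDerivAt
    have h3 := h2.mul (hasFDerivAt_coord i x)
    have h4 : fderiv ℝ (polyFun p) x (EuclideanSpace.single j 1) = _ := hp
    simp only [pd, h1]
    erw [h3.fderiv]
    simp only [Derivation.leibniz, polyFun_add, smul_eq_mul, polyFun_mul,
      add_apply, smul_apply, h4]
    by_cases hij : i = j
    · subst hij; simp [polyFun]
    · simp [polyFun, MvPolynomial.pderiv_X, hij]

theorem pd_eqOn {s : Set Pt} (hs : IsOpen s) {g h : Pt → ℝ} (hgh : Set.EqOn g h s) (j : Fin 2) :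
    Set.EqOn (pd j g) (pd j h) s := by
  intro x hx
  have : g =ᶠ[𝓝 x] h := hgh.eventuallyEq_of_mem (hs.mem_nhds hx)
  simp only [pd, this.fderiv_eq]

theorem pd_eqOn_polyFun {s : Set Pt} (hs : IsOpen s) {g : Pt → ℝ} {p : MvPolynomial (Fin 2) ℝ}
    (h : Set.EqOn g (polyFun p) s) (j : Fin 2) :
    Set.EqOn (pd j g) (polyFun (MvPolynomial.pderiv j p)) s := by
  rw [← pd_polyFun]
  exact pd_eqOn hs h j

section Operators

variable {s : Set Pt} {u w : Pt → Pt} {P Q : PolyPair}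

theorem eqOn_coord (h : Set.EqOn u (polyVec P) s) (i : Fin 2) :
    Set.EqOn (fun y => u y i) (polyFun (P i)) s := fun x hx => by
  simp only [h hx, polyVec_apply]

/-- The polynomial version of `eps`. -/
def epsP (P : PolyPair) (i j : Fin 2) : MvPolynomial (Fin 2) ℝ :=
  (1 / 2 : ℝ) • (MvPolynomial.pderiv j (P i) + MvPolynomial.pderiv i (P j))

/-- The polynomial version of `curl`. -/
def curlP (P : PolyPair) : MvPolynomial (Fin 2) ℝ :=
  MvPolynomial.pderiv 0 (P 1) - MvPolynomial.pderiv 1 (P 0)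

/-- The polynomial version of `conv`. -/
def convP (P Q : PolyPair) : PolyPair := fun i =>
  ∑ j, Q j * MvPolynomial.pderiv j (P i)

/-- The polynomial version of `divEps`. -/
def divEpsP (P : PolyPair) : PolyPair := fun i => ∑ j, MvPolynomial.pderiv j (epsP P i j)

theorem eps_eqOn (hs : IsOpen s) (h : Set.EqOn u (polyVec P) s) (i j : Fin 2) :
    Set.EqOn (eps u i j) (polyFun (epsP P i j)) s := fun x hx => by
  simp only [eps, epsP, pd_eqOn_polyFun hs (eqOn_coord h i) j hx,
    pd_eqOn_polyFun hs (eqOn_coord h j) i hx, polyFun_smul, polyFun_add]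
  ring

theorem curl_eqOn (hs : IsOpen s) (h : Set.EqOn u (polyVec P) s) :
    Set.EqOn (curl u) (polyFun (curlP P)) s := fun x hx => by
  simp only [curl, curlP, pd_eqOn_polyFun hs (eqOn_coord h _) _ hx, polyFun_sub]

theorem divg_eqOn (hs : IsOpen s) (h : Set.EqOn u (polyVec P) s) :
    Set.EqOn (divg u) (polyFun (∑ j, MvPolynomial.pderiv j (P j))) s := fun x hx => by
  simp only [divg, pd_eqOn_polyFun hs (eqOn_coord h _) _ hx, polyFun_sum]

theorem divEps_eqOn (hs : IsOpen s) (h : Set.EqOn u (polyVec P) s) :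
    Set.EqOn (divEps u) (polyVec (divEpsP P)) s := fun x hx => by
  ext i
  simp only [divEps, divEpsP, polyVec_apply, polyFun_sum,
    pd_eqOn_polyFun hs (eps_eqOn hs h _ _) _ hx]

theorem fderiv_apply_coord {u : Pt → Pt} {x : Pt} (hu : DifferentiableAt ℝ u x) (v : Pt)
    (i : Fin 2) : (fderiv ℝ u x v) i = ∑ j, v j * pd j (fun y => u y i) x := by
  have h1 : HasFDerivAt (fun y => u y i)
      ((EuclideanSpace.proj i : Pt →L[ℝ] ℝ).comp (fderiv ℝ u x)) x :=
    (EuclideanSpace.proj i : Pt →L[ℝ] ℝ).hasFDerivAt.comp x hu.hasFDerivAt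
  have h2 : v = ∑ j, v j • (EuclideanSpace.single j (1 : ℝ) : Pt) := by
    ext k; fin_cases k <;> simp [Fin.sum_univ_two]
  conv_lhs => rw [h2]
  simp only [pd, h1.fderiv, map_sum, map_smul]
  simp

theorem conv_eqOn (hs : IsOpen s) (h : Set.EqOn u (polyVec P) s) (h' : Set.EqOn w (polyVec Q) s) :
    Set.EqOn (conv u w) (polyVec (convP P Q)) s := fun x hx => by
  have hd : DifferentiableAt ℝ u x :=
    (differentiable_polyVec P x).congr_of_eventuallyEq (h.eventuallyEq_of_mem (hs.mem_nhds hx))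
  ext i
  simp only [conv, fderiv_apply_coord hd, convP, polyVec_apply, polyFun_sum, polyFun_mul, h' hx,
    pd_eqOn_polyFun hs (eqOn_coord h i) _ hx]

end Operators

/-! ### Piecewise polynomial fields in `V` -/

/-- `P` gives the polynomials of degree at most `m` which represent `u` on the triangles. -/
def Mesh.Repr (M : Mesh Ω) (m : ℕ) (u : Pt → Pt) (P : Finset Pt → PolyPair) : Prop :=
  ∀ E ∈ M.cells, (∀ i, (P E i).totalDegree ≤ m) ∧ Set.EqOn u (polyVec (P E)) (cell E)

theorem Mesh.IsPPoly.exists_repr {M : Mesh Ω} {m : ℕ} {u : Pt → Pt} (h : M.IsPPoly m u) :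
    ∃ P, M.Repr m u P := by
  choose! p hp hx using h
  refine ⟨p, fun E hE => ⟨hp E hE, fun x hxE => ?_⟩⟩
  ext i
  exact hx E hE i x hxE

theorem Mesh.cell_nonempty (M : Mesh Ω) {E : Finset Pt} (hE : E ∈ M.cells) :
    (cell E).Nonempty := by
  rw [Mesh.mem_cells] at hE
  rw [cell, interior_convexHull_nonempty_iff_affineSpan_eq_top]
  have := (M.K.indep hE.1).affineSpan_eq_top_iff_card_eq_finrank_add_one.2
    (by rw [Fintype.card_coe, hE.2, finrank_euclideanSpace_fin])
  simpa using this

theorem Mesh.hull_subset_closure_cell (M : Mesh Ω) {E : Finset Pt} (hE : E ∈ M.cells) :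
    convexHull ℝ (E : Set Pt) ⊆ closure (cell E) := by
  rw [cell, (convex_convexHull ℝ (E : Set Pt)).closure_interior_eq_closure_of_nonempty_interior
    (M.cell_nonempty hE)]
  exact subset_closure

theorem IsPolygonalDomain.isCompact_closure (hΩ : IsPolygonalDomain Ω) : IsCompact (closure Ω) :=
  hΩ.isBounded.isCompact_closure

theorem MemV.hasCompactSupport {u : Pt → Pt} (hΩ : IsPolygonalDomain Ω) (hu : MemV Ω u) :
    HasCompactSupport u :=
  HasCompactSupport.intro hΩ.isCompact_closure fun x hx =>
    hu.zero_off x fun h => hx (subset_closure h)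

/-- From every point, a ray in any direction starts inside one closed triangle, where u is
polynomial by continuity, or outside the closed domain, where u is zero. So u has a right derivative
along every line, bounded by a common constant, and the mean value inequality for right derivatives
applies without counting the crossings of edges. -/
theorem exists_lipschitz (hΩ : IsPolygonalDomain Ω) {M : Mesh Ω} {m : ℕ} {u : Pt → Pt}
    (hu : MemV Ω u) (hm : M.IsPPoly m u) : ∃ C, LipschitzWith C u := by
  obtain ⟨P, hP⟩ := hm.exists_repr
  have hbd : ∀ E, ∃ C : ℝ, ∀ x ∈ closure Ω, ‖fderiv ℝ (polyVec (P E)) x‖ ≤ C := fun E =>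
    hΩ.isCompact_closure.exists_bound_of_continuousOn
      ((contDiff_polyVec (P E)).continuous_fderiv (by simp)).continuousOn
  choose B hB using hbd
  set C : ℝ := ∑ E ∈ M.cells, |B E| with hC
  have hC0 : 0 ≤ C := Finset.sum_nonneg fun E _ => abs_nonneg _
  have hBC : ∀ E ∈ M.cells, ∀ x ∈ closure Ω, ‖fderiv ℝ (polyVec (P E)) x‖ ≤ C :=
    fun E hE x hx => (hB E x hx).trans ((le_abs_self _).trans
      (Finset.single_le_sum (f := fun E => |B E|) (fun _ _ => abs_nonneg _) hE))
  have hhull : ∀ E ∈ M.cells, Set.EqOn u (polyVec (P E)) (convexHull ℝ (E : Set Pt)) :=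
    fun E hE => ((hP E hE).2.closure hu.continuous (by fun_prop)).mono
      (M.hull_subset_closure_cell hE)
  refine ⟨⟨C, hC0⟩, LipschitzWith.of_dist_le_mul fun y x => ?_⟩
  rw [dist_eq_norm, dist_eq_norm]
  change _ ≤ C * _
  set d := y - x with hd
  have hpath : Continuous fun s : ℝ => x + s • d := by fun_prop
  have key : ∀ s : ℝ, ∃ f' : Pt, HasDerivWithinAt (fun s => u (x + s • d)) f' (Set.Ici s) s ∧
      ‖f'‖ ≤ C * ‖d‖ := by
    intro s
    have hloc : ∃ g : Pt → Pt, Differentiable ℝ g ∧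
        ‖fderiv ℝ g (x + s • d)‖ ≤ C ∧
        ∀ᶠ r in 𝓝[>] (0 : ℝ), u ((x + s • d) + r • d) = g ((x + s • d) + r • d) := by
      rcases M.ray_hull (x + s • d) d with ⟨E, hE, hEs⟩ | hout
      · refine ⟨polyVec (P E), differentiable_polyVec _, hBC E hE _ ?_, ?_⟩
        · refine M.hull_subset hE ((isCompact_hull E).isClosed.mem_of_tendsto (b := 𝓝[>] (0 : ℝ))
            (f := fun r : ℝ => (x + s • d) + r • d) ?_ hEs)
          have : Tendsto (fun r : ℝ => (x + s • d) + r • d) (𝓝 0)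
              (𝓝 ((x + s • d) + (0 : ℝ) • d)) := Continuous.tendsto (by fun_prop) _
          rw [zero_smul, add_zero] at this
          exact this.mono_left nhdsWithin_le_nhds
        · filter_upwards [hEs] with r hr using hhull E hE hr
      · refine ⟨fun _ => 0, differentiable_const 0, by simpa using hC0, ?_⟩
        filter_upwards [hout] with r hr
        exact hu.zero_off _ fun h => hr (subset_closure h)
    obtain ⟨g, hg, hgC, hgu⟩ := hloc
    have hev : ∀ᶠ s' in 𝓝[>] s, u (x + s' • d) = g (x + s' • d) := by
      have ht : Tendsto (fun s' : ℝ => s' - s) (𝓝[>] s) (𝓝[>] 0) := by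
        refine tendsto_nhdsWithin_iff.2 ⟨?_, ?_⟩
        · have : Tendsto (fun s' : ℝ => s' - s) (𝓝 s) (𝓝 (s - s)) :=
            Continuous.tendsto (by fun_prop) _
          rw [sub_self] at this
          exact this.mono_left nhdsWithin_le_nhds
        · filter_upwards [self_mem_nhdsWithin] with s' hs'
          exact sub_pos.2 (Set.mem_Ioi.1 hs')
      filter_upwards [ht.eventually hgu] with s' hs'
      have e : (x + s • d) + (s' - s) • d = x + s' • d := by rw [sub_smul]; abel
      rwa [e] at hs'
    -- The polynomial piece is known to agree with u only beyond s; continuity of both extends this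
    -- to s itself, as a right derivative at s requires.
    have heq : u (x + s • d) = g (x + s • d) := by
      have h1 : Tendsto (fun s' : ℝ => u (x + s' • d)) (𝓝[>] s) (𝓝 (u (x + s • d))) :=
        ((hu.continuous.comp hpath).tendsto s).mono_left nhdsWithin_le_nhds
      have h2 : Tendsto (fun s' : ℝ => g (x + s' • d)) (𝓝[>] s) (𝓝 (g (x + s • d))) :=
        ((hg.continuous.comp hpath).tendsto s).mono_left nhdsWithin_le_nhds
      exact tendsto_nhds_unique (h1.congr' hev) h2
    have hpd : HasDerivAt (fun s : ℝ => x + s • d) d s := by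
      simpa using ((hasDerivAt_id s).smul_const d).const_add x
    have hder : HasDerivAt (fun s : ℝ => g (x + s • d)) (fderiv ℝ g (x + s • d) d) s :=
      (hg (x + s • d)).hasFDerivAt.comp_hasDerivAt s hpd
    refine ⟨_, hder.hasDerivWithinAt.congr_of_eventuallyEq ?_ heq, ?_⟩
    · rw [← Set.Ioi_insert, nhdsWithin_insert]
      exact eventually_sup.2 ⟨eventually_pure.2 heq, hev⟩
    · exact (ContinuousLinearMap.le_opNorm _ _).trans
        (mul_le_mul_of_nonneg_right hgC (norm_nonneg _))
  choose f' hf' hf'C using key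
  have := norm_image_sub_le_of_norm_deriv_right_le_segment (a := (0 : ℝ)) (b := 1)
    (f := fun s => u (x + s • d)) (f' := f') (C := C * ‖d‖)
    (hu.continuous.comp hpath).continuousOn (fun s _ => hf' s) (fun s _ => hf'C s) 1 (by simp)
  simpa [hd] using this

/-! ### Vanishing of the convective form on divergence-free fields. -/

/-- Integration by parts for Lipschitz functions on the whole plane: ∫ (div u)|u|² = -∫ u·∇|u|² = -2
∫ ((∇u)u)·u. The divergence is only assumed to vanish after multiplication by |u|², so nothing about
it is needed where u is zero. -/
theorem integral_conv_self_eq_zero {u : Pt → Pt} {C : NNReal} (hu : LipschitzWith C u)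
    (hc : HasCompactSupport u) (hdiv : ∀ᵐ x, divg u x * ‖u x‖ ^ 2 = 0) :
    ∫ x, inner ℝ (conv u u x) (u x) = 0 := by
  obtain ⟨B, hB⟩ := hu.continuous.bounded_above_of_compact_support hc
  have hB0 : 0 ≤ B := (norm_nonneg _).trans (hB 0)
  have hg : LipschitzWith (2 * B.toNNReal * C) (fun x => ‖u x‖ ^ 2) := by
    refine LipschitzWith.of_dist_le_mul fun x y => ?_
    have h1 : ‖u x - u y‖ ≤ C * dist x y := by
      rw [← dist_eq_norm]; exact hu.dist_le_mul x y
    have h2 : |‖u x‖ - ‖u y‖| ≤ ‖u x - u y‖ := abs_norm_sub_norm_le _ _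
    rw [Real.dist_eq, show ‖u x‖ ^ 2 - ‖u y‖ ^ 2 = (‖u x‖ + ‖u y‖) * (‖u x‖ - ‖u y‖) by ring,
      abs_mul, abs_of_nonneg (by positivity)]
    calc (‖u x‖ + ‖u y‖) * |‖u x‖ - ‖u y‖| ≤ (2 * B) * (C * dist x y) :=
          mul_le_mul (by linarith [hB x, hB y]) (h2.trans h1) (abs_nonneg _) (by positivity)
      _ = _ := by push_cast [Real.coe_toNNReal B hB0]; ring
  have hgc : HasCompactSupport (fun x => ‖u x‖ ^ 2) :=
    hc.comp_left (g := fun v : Pt => ‖v‖ ^ 2) (by simp)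
  have hf : ∀ j, LipschitzWith C (fun x => u x j) := fun j => by
    refine LipschitzWith.of_dist_le_mul fun x y => ?_
    refine le_trans ?_ (hu.dist_le_mul x y)
    rw [Real.dist_eq, dist_eq_norm, ← PiLp.sub_apply, ← Real.norm_eq_abs]
    exact PiLp.norm_apply_le _ _
  have hfc : ∀ j, HasCompactSupport (fun x => u x j) := fun j =>
    hc.comp_left (g := fun v : Pt => v j) (by simp)
  have hibp := fun j : Fin 2 =>
    (hf j).integral_lineDeriv_mul_eq (μ := volume) hg hgc (EuclideanSpace.single j (1 : ℝ))
  have hI1 : ∀ j : Fin 2, Integrable (fun x =>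
      lineDeriv ℝ (fun x => u x j) x (EuclideanSpace.single j (1 : ℝ)) * ‖u x‖ ^ 2) := fun j =>
    (hg.continuous.integrable_of_hasCompactSupport hgc).bdd_mul
      (aestronglyMeasurable_lineDeriv (hf j).continuous volume)
      (.of_forall fun x => norm_lineDeriv_le_of_lipschitz ℝ (hf j))
  have hI2 : ∀ j : Fin 2, Integrable (fun x =>
      lineDeriv ℝ (fun x => ‖u x‖ ^ 2) x (-EuclideanSpace.single j (1 : ℝ)) * u x j) := fun j =>
    ((hf j).continuous.integrable_of_hasCompactSupport (hfc j)).bdd_mul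
      (aestronglyMeasurable_lineDeriv hg.continuous volume)
      (.of_forall fun x => norm_lineDeriv_le_of_lipschitz ℝ hg)
  have hsum := Finset.sum_congr rfl fun (j : Fin 2) (_ : j ∈ Finset.univ) => hibp j
  rw [← integral_finsetSum _ fun j _ => hI1 j, ← integral_finsetSum _ fun j _ => hI2 j] at hsum
  have hd : ∀ᵐ x, DifferentiableAt ℝ u x := hu.ae_differentiableAt
  have hL : ∀ᵐ x, ∑ j : Fin 2, lineDeriv ℝ (fun x => u x j) x (EuclideanSpace.single j (1 : ℝ)) *
      ‖u x‖ ^ 2 = 0 := by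
    filter_upwards [hd, hdiv] with x hx hx0
    have hxj : ∀ j : Fin 2, DifferentiableAt ℝ (fun x => u x j) x := fun j =>
      (hasFDerivAt_coord j (u x)).differentiableAt.comp x hx
    rw [← Finset.sum_mul]
    simp only [(hxj _).lineDeriv_eq_fderiv]
    exact hx0
  have hR : ∀ᵐ x, ∑ j : Fin 2, lineDeriv ℝ (fun x => ‖u x‖ ^ 2) x
      (-EuclideanSpace.single j (1 : ℝ)) * u x j = -2 * inner ℝ (conv u u x) (u x) := by
    filter_upwards [hd] with x hx
    have h1 := hx.hasFDerivAt.norm_sq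
    have h2 : u x = ∑ j, u x j • (EuclideanSpace.single j (1 : ℝ) : Pt) := by
      ext k; fin_cases k <;> simp [Fin.sum_univ_two]
    have h3 : conv u u x = ∑ j, u x j • fderiv ℝ u x (EuclideanSpace.single j (1 : ℝ)) := by
      rw [conv]
      conv_lhs => rw [h2]
      simp only [map_sum, map_smul]
    simp only [h1.differentiableAt.lineDeriv_eq_fderiv, h1.fderiv, h3, sum_inner,
      inner_smul_left, Finset.mul_sum]
    refine Finset.sum_congr rfl fun j _ => ?_
    simp [real_inner_comm (u x)]
    ring
  rw [integral_congr_ae hL, integral_congr_ae hR, integral_zero, integral_const_mul] at hsum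
  linarith

theorem formC_self_eq_zero (hΩ : IsPolygonalDomain Ω) {M : Mesh Ω} {m : ℕ} {u : Pt → Pt}
    (hu : MemV Ω u) (hm : M.IsPPoly m u) (hdiv : divg u =ᵐ[volume.restrict Ω] 0) :
    formC Ω u u u = 0 := by
  obtain ⟨C, hC⟩ := exists_lipschitz hΩ hu hm
  rw [formC, ip, setIntegral_eq_integral_of_forall_compl_eq_zero
    fun x hx => by simp [hu.zero_off x hx]]
  refine integral_conv_self_eq_zero hC (hu.hasCompactSupport hΩ) ?_
  have := (ae_restrict_iff' hΩ.isOpen.measurableSet).1 hdiv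
  filter_upwards [this] with x hx
  by_cases h : x ∈ Ω
  · rw [hx h]; simp
  · rw [hu.zero_off x h]; simp

/-! ### Jumps across edges and continuity in time of the edge form. -/

/-- The open triangles and the exterior of `Ω`. -/
def Mesh.regions (M : Mesh Ω) : Set (Set Pt) := insert (closure Ω)ᶜ (cell '' M.cells)

theorem Mesh.finite_regions (M : Mesh Ω) : M.regions.Finite :=
  (M.cells.finite_toSet.image _).insert _

theorem Mesh.cell_mem_regions (M : Mesh Ω) {E : Finset Pt} (hE : E ∈ M.cells) :
    cell E ∈ M.regions := Or.inr ⟨E, hE, rfl⟩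

theorem Mesh.isOpen_of_mem_regions (M : Mesh Ω) {R : Set Pt} (hR : R ∈ M.regions) : IsOpen R := by
  rcases hR with rfl | ⟨E, -, rfl⟩
  · exact isClosed_closure.isOpen_compl
  · exact isOpen_cell E

/-- The vector field `F` agrees with a polynomial one in each region. -/
def Mesh.PW (M : Mesh Ω) (F : Pt → Pt) : Prop :=
  ∀ R ∈ M.regions, ∃ P, Set.EqOn F (polyVec P) R

theorem Mesh.IsPPoly.pw {M : Mesh Ω} {m : ℕ} {u : Pt → Pt} (hm : M.IsPPoly m u)
    (hu : MemV Ω u) : M.PW u := by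
  obtain ⟨P, hP⟩ := hm.exists_repr
  rintro R (rfl | ⟨E, hE, rfl⟩)
  · refine ⟨0, fun x hx => ?_⟩
    rw [hu.zero_off x fun h => hx (subset_closure h)]
    ext i
    simp [polyFun]
  · exact ⟨P E, (hP E hE).2⟩

theorem Mesh.PW.add {M : Mesh Ω} {F G : Pt → Pt} (hF : M.PW F) (hG : M.PW G) : M.PW (F + G) := by
  intro R hR
  obtain ⟨P, hP⟩ := hF R hR
  obtain ⟨Q, hQ⟩ := hG R hR
  refine ⟨P + Q, fun x hx => ?_⟩
  ext i
  simp [hP hx, hQ hx]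

theorem Mesh.PW.smul {M : Mesh Ω} {F : Pt → Pt} (hF : M.PW F) (c : ℝ) : M.PW (c • F) := by
  intro R hR
  obtain ⟨P, hP⟩ := hF R hR
  refine ⟨c • P, fun x hx => ?_⟩
  ext i
  simp [hP hx]

theorem Mesh.PW.conv {M : Mesh Ω} {u w : Pt → Pt} (hu : M.PW u) (hw : M.PW w) :
    M.PW (conv u w) := by
  intro R hR
  obtain ⟨P, hP⟩ := hu R hR
  obtain ⟨Q, hQ⟩ := hw R hR
  exact ⟨convP P Q, conv_eqOn (M.isOpen_of_mem_regions hR) hP hQ⟩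

theorem Mesh.PW.differentiableAt {M : Mesh Ω} {u : Pt → Pt} (hu : M.PW u) {R : Set Pt}
    (hR : R ∈ M.regions) {x : Pt} (hx : x ∈ R) : DifferentiableAt ℝ u x := by
  obtain ⟨P, hP⟩ := hu R hR
  exact (differentiable_polyVec P x).congr_of_eventuallyEq
    (hP.eventuallyEq_of_mem ((M.isOpen_of_mem_regions hR).mem_nhds hx))

/-- The expansion of the convective derivative of an affine function of time. -/
theorem conv_affine {a b : Pt → Pt} {x : Pt} (ha : DifferentiableAt ℝ a x)
    (hb : DifferentiableAt ℝ b x) (t : ℝ) :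
    conv (a + t • b) (a + t • b) x =
      (conv a a + t • (conv a b + conv b a) + t ^ 2 • conv b b) x := by
  simp only [conv, Pi.add_apply, Pi.smul_apply]
  rw [fderiv_add ha (hb.const_smul t), fderiv_const_smul hb]
  simp only [add_apply, smul_apply, map_add, map_smul]
  module

theorem Mesh.PW.exists_bound {M : Mesh Ω} {F : Pt → Pt} (hF : M.PW F) {K : Set Pt}
    (hK : IsCompact K) : ∃ B : ℝ, ∀ R ∈ M.regions, ∀ x ∈ R ∩ K, ‖F x‖ ≤ B := by
  have : ∀ R ∈ M.regions, ∃ B : ℝ, ∀ x ∈ R ∩ K, ‖F x‖ ≤ B := by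
    intro R hR
    obtain ⟨P, hP⟩ := hF R hR
    obtain ⟨B, hB⟩ := hK.exists_bound_of_continuousOn (continuous_polyVec P).continuousOn
    exact ⟨B, fun x hx => by rw [hP hx.1]; exact hB x hx.2⟩
  choose! B hB using this
  obtain ⟨C, hC⟩ := (M.finite_regions.image B).bddAbove
  exact ⟨C, fun R hR x hx => (hB R hR x hx).trans (hC ⟨R, hR, rfl⟩)⟩

/-- For an arbitrary u the derivative applied to a fixed vector is measurable, so w is expanded in
the standard basis. -/
theorem measurable_conv {u w : Pt → Pt} (hw : Measurable w) : Measurable (conv u w) := by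
  have h : conv u w = fun x =>
      ∑ j, w x j • fderiv ℝ u x (EuclideanSpace.single j (1 : ℝ)) := by
    ext1 x
    have h2 : w x = ∑ j, w x j • (EuclideanSpace.single j (1 : ℝ) : Pt) := by
      ext k; fin_cases k <;> simp [Fin.sum_univ_two]
    rw [conv]
    conv_lhs => rw [h2]
    simp only [map_sum, map_smul]
  rw [h]
  refine Finset.measurable_sum _ fun j _ => ?_
  exact ((measurable_pi_apply j).comp ((WithLp.measurable_ofLp 2 _).comp hw)).smul
    (measurable_fderiv_apply_const ℝ u _)

section Edge

/-- The exterior counts as a region, since fields of V vanish there and are thus polynomial. This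
avoids deciding which edges have triangles on both sides. -/
theorem Mesh.ray_region {M : Mesh Ω} {e : Finset Pt} (he : e ∈ M.K.faces)
    (h2 : e.card = 2) {x : Pt} (hx : x ∈ convexHull ℝ (e : Set Pt)) (hxe : x ∉ e) {c : ℝ}
    (hc : c ≠ 0) : ∃ R ∈ M.regions, ∀ᶠ s in 𝓝[>] (0 : ℝ), x + s • (c • M.normal e) ∈ R := by
  have hn : M.normal e ≠ 0 := by
    rw [← norm_ne_zero_iff, M.norm_normal e he h2]; exact one_ne_zero
  rcases M.ray_cell he h2 (smul_ne_zero hc hn)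
    (fun a ha b hb => by rw [inner_smul_left, M.normal_orth e he h2 a ha b hb, mul_zero])
    hx hxe with ⟨E, hE, h⟩ | h
  · exact ⟨_, M.cell_mem_regions hE, h⟩
  · exact ⟨_, Or.inl rfl, h⟩

theorem Mesh.PW.tendsto_ray {M : Mesh Ω} {e : Finset Pt} (he : e ∈ M.K.faces)
    (h2 : e.card = 2) {F : Pt → Pt} (hF : M.PW F) {x : Pt}
    (hx : x ∈ convexHull ℝ (e : Set Pt)) (hxe : x ∉ e) {c : ℝ} (hc : c ≠ 0) :
    ∃ L, Tendsto (fun s : ℝ => F (x + s • (c • M.normal e))) (𝓝[>] 0) (𝓝 L) := by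
  obtain ⟨R, hR, h⟩ := M.ray_region he h2 hx hxe hc
  obtain ⟨P, hP⟩ := hF R hR
  have ht : Tendsto (fun s : ℝ => polyVec P (x + s • (c • M.normal e))) (𝓝[>] 0)
      (𝓝 (polyVec P (x + (0 : ℝ) • (c • M.normal e)))) :=
    (Continuous.tendsto (by fun_prop) _).mono_left nhdsWithin_le_nhds
  exact ⟨_, ht.congr' (h.mono fun s hs => (hP hs).symm)⟩

theorem Mesh.PW.tendsto_jump {M : Mesh Ω} {e : Finset Pt} (he : e ∈ M.K.faces)
    (h2 : e.card = 2) {F : Pt → Pt} (hF : M.PW F) {x : Pt}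
    (hx : x ∈ convexHull ℝ (e : Set Pt)) (hxe : x ∉ e)
    (hfr : ¬ convexHull ℝ (e : Set Pt) ⊆ frontier Ω) :
    Tendsto (fun s => F (x - s • M.normal e) - F (x + s • M.normal e)) (𝓝[>] (0 : ℝ))
      (𝓝 (M.jump e F x)) := by
  obtain ⟨L, hL⟩ := hF.tendsto_ray he h2 hx hxe (neg_ne_zero.2 one_ne_zero)
  obtain ⟨L', hL'⟩ := hF.tendsto_ray he h2 hx hxe one_ne_zero
  simp only [neg_smul, one_smul, smul_neg, ← sub_eq_add_neg] at hL hL'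
  rw [Mesh.jump, if_neg hfr]
  exact tendsto_nhds_limUnder ⟨_, hL.sub hL'⟩

/-- `limUnder` is additive only where the limits exist, which `Mesh.PW.tendsto_jump` provides away
from the vertices. The expansion of the convective derivative is used only at the points x ± s n,
inside open regions where both fields are differentiable. -/
theorem Mesh.jump_conv_affine {M : Mesh Ω} {e : Finset Pt} (he : e ∈ M.K.faces)
    (h2 : e.card = 2) {a b : Pt → Pt} (ha : M.PW a) (hb : M.PW b) {x : Pt}
    (hx : x ∈ convexHull ℝ (e : Set Pt)) (hxe : x ∉ e) (t : ℝ) :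
    M.jump e (VortStab.conv (a + t • b) (a + t • b)) x =
      M.jump e (VortStab.conv a a) x +
        t • M.jump e (VortStab.conv a b + VortStab.conv b a) x +
        t ^ 2 • M.jump e (VortStab.conv b b) x := by
  by_cases hfr : convexHull ℝ (e : Set Pt) ⊆ frontier Ω
  · simp [Mesh.jump, hfr]
  have hab := ha.add (hb.smul t)
  refine tendsto_nhds_unique ((hab.conv hab).tendsto_jump he h2 hx hxe hfr) ?_
  have h1 := ((((ha.conv ha).tendsto_jump he h2 hx hxe hfr).add
    ((((ha.conv hb).add (hb.conv ha)).tendsto_jump he h2 hx hxe hfr).const_smul t)).add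
    (((hb.conv hb).tendsto_jump he h2 hx hxe hfr).const_smul (t ^ 2)))
  refine h1.congr' ?_
  obtain ⟨R, hR, h⟩ := M.ray_region he h2 hx hxe (neg_ne_zero.2 one_ne_zero)
  obtain ⟨R', hR', h'⟩ := M.ray_region he h2 hx hxe one_ne_zero
  simp only [neg_smul, one_smul, smul_neg, ← sub_eq_add_neg] at h h'
  filter_upwards [h, h'] with s hs hs'
  rw [conv_affine (ha.differentiableAt hR hs) (hb.differentiableAt hR hs),
    conv_affine (ha.differentiableAt hR' hs') (hb.differentiableAt hR' hs')]
  simp only [Pi.add_apply, Pi.smul_apply]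
  module

theorem hausdorffMeasure_edge_lt_top {e : Finset Pt} (h2 : e.card = 2) :
    Measure.hausdorffMeasure 1 (convexHull ℝ (e : Set Pt)) < ⊤ := by
  classical
  obtain ⟨p, q, -, rfl⟩ := Finset.card_eq_two.1 h2
  rw [Finset.coe_pair, convexHull_pair, hausdorffMeasure_segment]
  exact edist_lt_top p q

/-- Points are null for the one-dimensional Hausdorff measure, so the vertices, where a jump may be
a meaningless default value, do not matter. -/
theorem ae_edge {e : Finset Pt} : ∀ᵐ x ∂((Measure.hausdorffMeasure 1).restrict (convexHull ℝ (e : Set Pt))),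
    x ∈ convexHull ℝ (e : Set Pt) ∧ x ∉ e := by
  have : NullSingletonClass (Measure.hausdorffMeasure 1 : Measure Pt) :=
    Measure.nullSingletonClass_hausdorff Pt one_pos
  have h1 := ae_restrict_mem (μ := (Measure.hausdorffMeasure 1 : Measure Pt))
    (isCompact_hull e).isClosed.measurableSet
  have h3 : ∀ᵐ x ∂((Measure.hausdorffMeasure 1 : Measure Pt).restrict
      (convexHull ℝ (e : Set Pt))), x ∉ (e : Set Pt) :=
    ae_restrict_of_ae (measure_eq_zero_iff_ae_notMem.1 (e.finite_toSet.measure_zero _))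
  filter_upwards [h1, h3] with x hx hx' using ⟨hx, hx'⟩

theorem Mesh.PW.aestronglyMeasurable_jump {M : Mesh Ω} {e : Finset Pt} (he : e ∈ M.K.faces)
    (h2 : e.card = 2) {F : Pt → Pt} (hF : M.PW F) (hm : Measurable F) :
    AEStronglyMeasurable (M.jump e F)
      ((Measure.hausdorffMeasure 1).restrict (convexHull ℝ (e : Set Pt))) := by
  by_cases hfr : convexHull ℝ (e : Set Pt) ⊆ frontier Ω
  · have : M.jump e F = 0 := by ext1 x; simp [Mesh.jump, hfr]
    rw [this]
    exact aestronglyMeasurable_zero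
  have hs : Tendsto (fun n : ℕ => 1 / ((n : ℝ) + 1)) atTop (𝓝[>] 0) :=
    tendsto_nhdsWithin_iff.2 ⟨tendsto_one_div_add_atTop_nhds_zero_nat,
      .of_forall fun n => Set.mem_Ioi.2 (by positivity)⟩
  refine aestronglyMeasurable_of_tendsto_ae atTop (f := fun (n : ℕ) x =>
    F (x - (1 / ((n : ℝ) + 1)) • M.normal e) - F (x + (1 / ((n : ℝ) + 1)) • M.normal e))
    (fun n => ?_) ?_
  · exact Measurable.aestronglyMeasurable
      ((hm.comp (measurable_id.sub_const _)).sub (hm.comp (measurable_id.add_const _)))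
  · filter_upwards [ae_edge (e := e)] with x hx
    exact (hF.tendsto_jump he h2 hx.1 hx.2 hfr).comp hs

theorem Mesh.PW.exists_bound_jump {M : Mesh Ω} {e : Finset Pt} (he : e ∈ M.K.faces)
    (h2 : e.card = 2) {F : Pt → Pt} (hF : M.PW F) :
    ∃ B : ℝ, 0 ≤ B ∧ ∀ x ∈ convexHull ℝ (e : Set Pt), x ∉ e → ‖M.jump e F x‖ ≤ B := by
  -- Radius r + 1 leaves room for a displacement of length s ≤ 1 along the unit normal.
  obtain ⟨r, hr⟩ := (isCompact_hull e).isBounded.subset_closedBall (0 : Pt)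
  obtain ⟨B, hB⟩ := hF.exists_bound (isCompact_closedBall (0 : Pt) (r + 1))
  refine ⟨|B| + |B|, by positivity, fun x hx hxe => ?_⟩
  by_cases hfr : convexHull ℝ (e : Set Pt) ⊆ frontier Ω
  · simp only [Mesh.jump, hfr, if_true, norm_zero]; positivity
  refine le_of_tendsto (hF.tendsto_jump he h2 hx hxe hfr).norm ?_
  obtain ⟨R, hR, h⟩ := M.ray_region he h2 hx hxe (neg_ne_zero.2 one_ne_zero)
  obtain ⟨R', hR', h'⟩ := M.ray_region he h2 hx hxe one_ne_zero
  simp only [neg_smul, one_smul, smul_neg, ← sub_eq_add_neg] at h h'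
  have hxr : ‖x‖ ≤ r := by simpa using hr hx
  filter_upwards [h, h', Ioo_mem_nhdsGT (zero_lt_one' ℝ)] with s hs hs' hs1
  have hsn : ‖s • M.normal e‖ ≤ 1 := by
    rw [norm_smul, M.norm_normal e he h2, Real.norm_of_nonneg hs1.1.le, mul_one]
    exact hs1.2.le
  refine (norm_sub_le _ _).trans (add_le_add ?_ ?_)
  · refine (hB R hR _ ⟨hs, ?_⟩).trans (le_abs_self B)
    rw [mem_closedBall_zero_iff]
    exact (norm_sub_le _ _).trans (add_le_add hxr hsn)
  · refine (hB R' hR' _ ⟨hs', ?_⟩).trans (le_abs_self B)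
    rw [mem_closedBall_zero_iff]
    exact (norm_add_le _ _).trans (add_le_add hxr hsn)

end Edge

theorem continuous_integral_of_locally_bounded {X : Type*} [MeasurableSpace X] {μ : Measure X}
    [IsFiniteMeasure μ] {F : ℝ → X → ℝ} (hm : ∀ t, AEStronglyMeasurable (F t) μ)
    (hb : ∀ r, ∃ B : ℝ, ∀ t, |t| ≤ r → ∀ᵐ x ∂μ, ‖F t x‖ ≤ B)
    (hc : ∀ᵐ x ∂μ, Continuous fun t => F t x) : Continuous fun t => ∫ x, F t x ∂μ := by
  rw [continuous_iff_continuousAt]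
  intro t₀
  obtain ⟨B, hB⟩ := hb (|t₀| + 1)
  refine continuousAt_of_dominated (bound := fun _ => B) (.of_forall hm) ?_
    (integrable_const B) (hc.mono fun x hx => hx.continuousAt)
  have : ∀ᶠ t in 𝓝 t₀, |t| < |t₀| + 1 :=
    continuous_abs.continuousAt.eventually_lt continuousAt_const (by linarith)
  filter_upwards [this] with t ht using hB t ht.le

theorem Mesh.face_of_mem_powersetCard {M : Mesh Ω} {E e : Finset Pt} (hE : E ∈ M.cells)
    (he : e ∈ E.powersetCard 2) : e ∈ M.K.faces ∧ e.card = 2 := by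
  rw [Finset.mem_powersetCard] at he
  exact ⟨M.K.down_closed (Mesh.mem_cells.1 hE).1 he.1 (Finset.card_pos.1 (by omega)), he.2⟩

/-- The jump of the convective derivative is quadratic in t with bounded measurable coefficients, so
dominated convergence applies on each edge. -/
theorem continuous_stabJ_affine {M : Mesh Ω} {a b : Pt → Pt} (ha : M.PW a) (hb : M.PW b)
    (ham : Measurable a) (hbm : Measurable b) :
    Continuous fun t => stabJ M (fun t => a + t • b) (fun t => a + t • b)
      (fun t => a + t • b) (fun t => a + t • b) t := by
  unfold stabJ
  refine continuous_finsetSum _ fun E hE => continuous_const.mul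
    (continuous_finsetSum _ fun e he => ?_)
  obtain ⟨hf, h2⟩ := Mesh.face_of_mem_powersetCard hE he
  have : IsFiniteMeasure ((Measure.hausdorffMeasure 1).restrict (convexHull ℝ (e : Set Pt))) :=
    ⟨by rw [Measure.restrict_apply_univ]; exact hausdorffMeasure_edge_lt_top h2⟩
  have h0 := ha.conv ha
  have h1 := (ha.conv hb).add (hb.conv ha)
  have h3 := hb.conv hb
  set J₀ := M.jump e (conv a a)
  set J₁ := M.jump e (conv a b + conv b a)
  set J₂ := M.jump e (conv b b)
  have m0 : AEStronglyMeasurable J₀ _ :=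
    h0.aestronglyMeasurable_jump hf h2 (measurable_conv ham)
  have m1 : AEStronglyMeasurable J₁ _ :=
    h1.aestronglyMeasurable_jump hf h2 ((measurable_conv hbm).add (measurable_conv ham))
  have m2 : AEStronglyMeasurable J₂ _ :=
    h3.aestronglyMeasurable_jump hf h2 (measurable_conv hbm)
  obtain ⟨B₀, p0, b0⟩ := h0.exists_bound_jump hf h2
  obtain ⟨B₁, p1, b1⟩ := h1.exists_bound_jump hf h2
  obtain ⟨B₂, p2, b2⟩ := h3.exists_bound_jump hf h2
  have heq : (fun t : ℝ => ∫ x in convexHull ℝ (e : Set Pt),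
      inner ℝ (M.jump e (conv (a + t • b) (a + t • b)) x)
        (M.jump e (conv (a + t • b) (a + t • b)) x) ∂(Measure.hausdorffMeasure 1)) =
      fun t : ℝ => ∫ x in convexHull ℝ (e : Set Pt),
        ‖J₀ x + t • J₁ x + t ^ 2 • J₂ x‖ ^ 2 ∂(Measure.hausdorffMeasure 1) := by
    ext t
    refine integral_congr_ae ?_
    filter_upwards [ae_edge (e := e)] with x hx
    rw [Mesh.jump_conv_affine hf h2 ha hb hx.1 hx.2, real_inner_self_eq_norm_sq]
  rw [heq]
  refine continuous_integral_of_locally_bounded (fun t => ?_) (fun r => ?_) ?_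
  · exact (((m0.add (m1.const_smul t)).add (m2.const_smul (t ^ 2))).norm).pow 2
  · refine ⟨(B₀ + r * B₁ + r ^ 2 * B₂) ^ 2, fun t ht => ?_⟩
    filter_upwards [ae_edge (e := e)] with x hx
    rw [norm_pow, norm_norm]
    refine pow_le_pow_left₀ (norm_nonneg _) ?_ 2
    refine (norm_add₃_le).trans ?_
    rw [norm_smul, norm_smul, norm_pow, Real.norm_eq_abs]
    have hr : 0 ≤ r := (abs_nonneg t).trans ht
    gcongr
    · exact b0 x hx.1 hx.2
    · exact b1 x hx.1 hx.2
    · exact b2 x hx.1 hx.2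
  · exact .of_forall fun x => by fun_prop

theorem stabJ_self_nonneg (M : Mesh Ω) (w v : ℝ → Pt → Pt) (t : ℝ) : 0 ≤ stabJ M w w v v t := by
  refine Finset.sum_nonneg fun E _ => mul_nonneg (by positivity)
    (Finset.sum_nonneg fun e _ => integral_nonneg fun x => real_inner_self_nonneg)

/-! ### Inverse estimate and coercivity on one triangle. -/

/-- The commutator of two derivations is a derivation, and this one kills the variables. -/
theorem pderiv_comm (i j : Fin 2) (p : MvPolynomial (Fin 2) ℝ) :
    MvPolynomial.pderiv i (MvPolynomial.pderiv j p) =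
      MvPolynomial.pderiv j (MvPolynomial.pderiv i p) := by
  classical
  have h : ⁅(MvPolynomial.pderiv i : Derivation ℝ (MvPolynomial (Fin 2) ℝ) (MvPolynomial (Fin 2) ℝ)),
      (MvPolynomial.pderiv j : Derivation ℝ (MvPolynomial (Fin 2) ℝ) (MvPolynomial (Fin 2) ℝ))⁆ =
      0 := by
    refine MvPolynomial.derivation_ext fun k => ?_
    rw [Derivation.commutator_apply, MvPolynomial.pderiv_X, MvPolynomial.pderiv_X]
    by_cases hj : k = j <;> by_cases hi : k = i <;> simp [Pi.single_apply, hi, hj] <;>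
      split_ifs <;> simp
  have := congrArg (fun D => D p) h
  rw [Derivation.commutator_apply, Derivation.zero_apply, sub_eq_zero] at this
  exact this

theorem totalDegree_pderiv_le {m : ℕ} (i : Fin 2) {p : MvPolynomial (Fin 2) ℝ}
    (hp : p.totalDegree ≤ m + 1) : (MvPolynomial.pderiv i p).totalDegree ≤ m := by
  rw [MvPolynomial.totalDegree, Finset.sup_le_iff]
  intro s hs
  rw [MvPolynomial.mem_support_iff, MvPolynomial.coeff_pderiv] at hs
  have h1 : s + Finsupp.single i 1 ∈ p.support :=
    MvPolynomial.mem_support_iff.2 (left_ne_zero_of_mul hs)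
  have h2 := MvPolynomial.le_totalDegree h1
  rw [Finsupp.sum_add_index' (by simp) (by simp), Finsupp.sum_single_index rfl] at h2
  omega

theorem totalDegree_epsP_le {m : ℕ} {P : PolyPair} (hP : ∀ i, (P i).totalDegree ≤ m + 1)
    (i j : Fin 2) : (epsP P i j).totalDegree ≤ m :=
  (MvPolynomial.totalDegree_smul_le _ _).trans ((MvPolynomial.totalDegree_add _ _).trans
    (max_le (totalDegree_pderiv_le j (hP i)) (totalDegree_pderiv_le i (hP j))))

theorem normSqE_nonneg (E : Finset Pt) (g : Pt → ℝ) : 0 ≤ normSqE E g :=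
  integral_nonneg fun _ => sq_nonneg _

theorem normSqW2E_nonneg (E : Finset Pt) (g : Pt → ℝ) : 0 ≤ normSqW2E E g := by
  unfold normSqW2E
  have := normSqE_nonneg E
  linarith [this g, this (pd 0 g), this (pd 1 g), this (pd 0 (pd 0 g)), this (pd 0 (pd 1 g)),
    this (pd 1 (pd 1 g))]

theorem invConst_nonneg (m : ℕ) (E : Finset Pt) : 0 ≤ invConst m E :=
  Real.sInf_nonneg fun _ h => h.1.le

/-- The infimum defining the constant of the inverse estimate is attained. -/
theorem normSqW2E_le_of_invConst_pos {m : ℕ} {E : Finset Pt} (h : 0 < invConst m E)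
    {p : MvPolynomial (Fin 2) ℝ} (hp : p.totalDegree ≤ m) :
    normSqW2E E (polyFun p) ≤
      invConst m E ^ 2 * ((diamE E ^ 2)⁻¹) ^ 2 * normSqE E (polyFun p) := by
  -- A positive value excludes the empty set, whose infimum is 0 by convention.
  have hne : {γ : ℝ | 0 < γ ∧ ∀ p : MvPolynomial (Fin 2) ℝ, p.totalDegree ≤ m →
      √(normSqW2E E (polyFun p)) ≤ γ * (diamE E ^ 2)⁻¹ * √(normSqE E (polyFun p))}.Nonempty := by
    by_contra hc
    rw [Set.not_nonempty_iff_eq_empty] at hc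
    rw [invConst, hc, Real.sInf_empty] at h
    exact lt_irrefl _ h
  have key : √(normSqW2E E (polyFun p)) ≤
      invConst m E * ((diamE E ^ 2)⁻¹ * √(normSqE E (polyFun p))) := by
    have h1 : Tendsto (fun γ : ℝ => γ * ((diamE E ^ 2)⁻¹ * √(normSqE E (polyFun p))))
        (𝓝[>] (invConst m E)) (𝓝 (invConst m E * ((diamE E ^ 2)⁻¹ *
          √(normSqE E (polyFun p))))) :=
      (Continuous.tendsto (by fun_prop) _).mono_left nhdsWithin_le_nhds
    refine ge_of_tendsto h1 ?_
    filter_upwards [self_mem_nhdsWithin] with γ hγ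
    obtain ⟨γ', hγ', hlt⟩ := exists_lt_of_csInf_lt hne (Set.mem_Ioi.1 hγ)
    refine (hγ'.2 p hp).trans ?_
    rw [mul_assoc]
    exact mul_le_mul_of_nonneg_right hlt.le (by positivity)
  have := pow_le_pow_left₀ (Real.sqrt_nonneg _) key 2
  rw [Real.sq_sqrt (normSqW2E_nonneg _ _), mul_pow, mul_pow,
    Real.sq_sqrt (normSqE_nonneg _ _)] at this
  linarith

theorem delta_mul_normSqW2E_le {m : ℕ} {E : Finset Pt} {ν δ : ℝ} (hν : 0 < ν) (hδ : 0 ≤ δ)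
    (hδ' : δ ≤ diamE E ^ 4 / (ν * invConst m E ^ 2)) {p : MvPolynomial (Fin 2) ℝ}
    (hp : p.totalDegree ≤ m) :
    δ * ν * normSqW2E E (polyFun p) ≤ normSqE E (polyFun p) := by
  have hN := normSqE_nonneg E (polyFun p)
  -- If the constant vanishes, the bound on δ is a quotient by zero, that is 0, so δ = 0. A
  -- vanishing diameter also forces δ = 0.
  rcases (invConst_nonneg m E).eq_or_lt with h | h
  · rw [← h] at hδ'
    have : δ = 0 := le_antisymm (by simpa using hδ') hδ
    simpa [this] using hN
  by_cases hd : diamE E = 0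
  · rw [hd] at hδ'
    have : δ = 0 := le_antisymm (by simpa using hδ') hδ
    simpa [this] using hN
  calc δ * ν * normSqW2E E (polyFun p)
      ≤ (diamE E ^ 4 / (ν * invConst m E ^ 2)) * ν *
        (invConst m E ^ 2 * ((diamE E ^ 2)⁻¹) ^ 2 * normSqE E (polyFun p)) := by
        have := normSqW2E_nonneg E (polyFun p)
        have := normSqW2E_le_of_invConst_pos h hp
        gcongr
    _ = normSqE E (polyFun p) := by field_simp

theorem integrableOn_cell {f : Pt → ℝ} (hf : Continuous f) (E : Finset Pt) :
    IntegrableOn f (cell E) :=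
  (hf.continuousOn.integrableOn_compact (isCompact_hull E)).mono_set (cell_subset E)

theorem epsP_symm (P : PolyPair) (i j : Fin 2) : epsP P i j = epsP P j i := by
  rw [epsP, epsP, add_comm]

/-- The viscous term in the vorticity equation is controlled by the symmetric gradient. -/
theorem delta_mul_integral_curl_divEps_le {m : ℕ} {E : Finset Pt} {ν δ : ℝ} (hν : 0 < ν)
    (hδ : 0 ≤ δ) (hδ' : δ ≤ diamE E ^ 4 / (ν * invConst m E ^ 2)) {P : PolyPair}
    (hP : ∀ i, (P i).totalDegree ≤ m + 1) :
    δ * ν * ∫ x in cell E, polyFun (curlP (divEpsP P)) x ^ 2 ≤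
      3 * ∫ x in cell E, ∑ i, ∑ j, polyFun (epsP P i j) x * polyFun (epsP P i j) x := by
  set D := fun (i j : Fin 2) p => MvPolynomial.pderiv (R := ℝ) i (MvPolynomial.pderiv j p)
    with hD
  have hI : ∀ p, IntegrableOn (fun x => polyFun p x ^ 2) (cell E) := fun p =>
    integrableOn_cell ((continuous_polyFun p).pow 2) E
  have hW : ∀ p, normSqE E (polyFun (D 0 0 p)) + normSqE E (polyFun (D 1 1 p)) ≤
      normSqW2E E (polyFun p) := fun p => by
    have h := normSqE_nonneg E
    simp only [normSqW2E, pd_polyFun, hD]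
    linarith [h (polyFun p), h (polyFun (MvPolynomial.pderiv 0 p)),
      h (polyFun (MvPolynomial.pderiv 1 p)),
      h (polyFun (MvPolynomial.pderiv 0 (MvPolynomial.pderiv 1 p)))]
  have hW' : ∀ p, normSqE E (polyFun (D 0 1 p)) ≤ normSqW2E E (polyFun p) := fun p => by
    have h := normSqE_nonneg E
    simp only [normSqW2E, pd_polyFun, hD]
    linarith [h (polyFun p), h (polyFun (MvPolynomial.pderiv 0 p)),
      h (polyFun (MvPolynomial.pderiv 1 p)),
      h (polyFun (MvPolynomial.pderiv 0 (MvPolynomial.pderiv 0 p))),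
      h (polyFun (MvPolynomial.pderiv 1 (MvPolynomial.pderiv 1 p)))]
  have hexp : ∀ x, polyFun (curlP (divEpsP P)) x =
      (polyFun (D 0 0 (epsP P 0 1)) x - polyFun (D 1 1 (epsP P 0 1)) x) +
        (polyFun (D 0 1 (epsP P 1 1)) x - polyFun (D 0 1 (epsP P 0 0)) x) := fun x => by
    simp only [curlP, divEpsP, Fin.sum_univ_two, map_add, polyFun_sub, polyFun_add, hD,
      epsP_symm P 1 0, pderiv_comm 1 0 (epsP P 0 0)]
    ring
  -- With X = a - b from the off-diagonal entry and Y = c - d from the diagonal ones, (X + Y)² ≤ 3X²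
  -- + (3/2)Y² ≤ 6(a² + b²) + 3(c² + d²). The weights 6 and 3 match ε : ε, which counts the
  -- off-diagonal entry twice, and this produces the overall factor 3.
  have h1 : ∫ x in cell E, polyFun (curlP (divEpsP P)) x ^ 2 ≤
      6 * (normSqE E (polyFun (D 0 0 (epsP P 0 1))) + normSqE E (polyFun (D 1 1 (epsP P 0 1)))) +
        3 * (normSqE E (polyFun (D 0 1 (epsP P 1 1))) +
          normSqE E (polyFun (D 0 1 (epsP P 0 0)))) := by
    unfold normSqE
    rw [← integral_add (hI _) (hI _), ← integral_add (hI _) (hI _), ← integral_const_mul,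
      ← integral_const_mul, ← integral_add (((hI _).fun_add (hI _)).const_mul _)
        (((hI _).fun_add (hI _)).const_mul _)]
    refine integral_mono (hI _) ((((hI _).fun_add (hI _)).const_mul _).fun_add
        (((hI _).fun_add (hI _)).const_mul _)) fun x => ?_
    simp only [hexp]
    generalize polyFun (D 0 0 (epsP P 0 1)) x = a
    generalize polyFun (D 1 1 (epsP P 0 1)) x = b
    generalize polyFun (D 0 1 (epsP P 1 1)) x = c
    generalize polyFun (D 0 1 (epsP P 0 0)) x = d
    nlinarith [sq_nonneg (2 * (a - b) - (c - d)), sq_nonneg (a + b), sq_nonneg (c + d)]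
  have h2 : ∫ x in cell E, ∑ i, ∑ j, polyFun (epsP P i j) x * polyFun (epsP P i j) x =
      normSqE E (polyFun (epsP P 0 0)) + 2 * normSqE E (polyFun (epsP P 0 1)) +
        normSqE E (polyFun (epsP P 1 1)) := by
    unfold normSqE
    rw [← integral_const_mul, ← integral_add (hI _) ((hI _).const_mul _),
      ← integral_add ((hI _).fun_add ((hI _).const_mul _)) (hI _)]
    refine integral_congr_ae (.of_forall fun x => ?_)
    simp only [Fin.sum_univ_two, epsP_symm P 1 0]
    ring
  have hk := fun i j => delta_mul_normSqW2E_le hν hδ hδ' (totalDegree_epsP_le hP i j)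
  rw [h2]
  have h3 := mul_le_mul_of_nonneg_left (h1.trans (add_le_add
    (mul_le_mul_of_nonneg_left (hW (epsP P 0 1)) (by norm_num))
    (mul_le_mul_of_nonneg_left (add_le_add (hW' (epsP P 1 1)) (hW' (epsP P 0 0)))
      (by norm_num)))) (mul_nonneg hδ hν.le)
  have k1 := hk 0 0
  have k2 := hk 0 1
  have k3 := hk 1 1
  nlinarith

/-- Coercivity of the stabilised form on a triangle. -/
theorem cell_coercivity {m : ℕ} {E : Finset Pt} {ν δ : ℝ} (hν : 0 < ν)
    (hδ : 0 ≤ δ) (hδ' : δ ≤ diamE E ^ 4 / (ν * invConst m E ^ 2)) {P : PolyPair}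
    (hP : ∀ i, (P i).totalDegree ≤ m + 1) (q : MvPolynomial (Fin 2) ℝ) {g : Pt → ℝ}
    (hg : MemLp g 2 (volume.restrict (cell E))) :
    -(δ * ∫ x in cell E, g x ^ 2) ≤
      ν * (∫ x in cell E, ∑ i, ∑ j, polyFun (epsP P i j) x * polyFun (epsP P i j) x) +
        δ * (∫ x in cell E, polyFun q x * polyFun q x) +
        δ * (∫ x in cell E, polyFun ((-ν) • curlP (divEpsP P)) x * polyFun q x) -
        δ * ∫ x in cell E, g x * polyFun q x := by
  have hfin : IsFiniteMeasure (volume.restrict (cell E)) :=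
    ⟨by
      rw [Measure.restrict_apply_univ]
      exact (measure_mono (cell_subset E)).trans_lt (isCompact_hull E).measure_lt_top⟩
  have hq : MemLp (polyFun q) 2 (volume.restrict (cell E)) := by
    obtain ⟨B, hB⟩ := (isCompact_hull E).exists_bound_of_continuousOn
      (continuous_polyFun q).continuousOn
    refine MemLp.of_bound (continuous_polyFun q).aestronglyMeasurable B ?_
    filter_upwards [ae_restrict_mem (measurableSet_cell E)] with x hx
    exact hB x (cell_subset E hx)
  have i1 : IntegrableOn (fun x => polyFun q x * polyFun q x) (cell E) :=
    integrableOn_cell (by fun_prop) E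
  have i2 : IntegrableOn (fun x => polyFun ((-ν) • curlP (divEpsP P)) x * polyFun q x) (cell E) :=
    integrableOn_cell (by fun_prop) E
  have i3 : IntegrableOn (fun x => g x * polyFun q x) (cell E) := hg.integrable_mul hq
  have i4 : IntegrableOn (fun x => g x ^ 2) (cell E) := hg.integrable_sq
  have i5 : IntegrableOn (fun x => polyFun (curlP (divEpsP P)) x ^ 2) (cell E) :=
    integrableOn_cell (by fun_prop) E
  -- Three quarters of v² go to the viscous product and one quarter to the load: the integrand
  -- equals (3v - 2νd)²/12 + (v - 2g)²/4. The coefficient ν²/3 of d² then meets the factor 3 of the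
  -- inverse estimate and uses up the viscous form exactly.
  have key : 0 ≤ (∫ x in cell E, polyFun q x * polyFun q x) +
      (∫ x in cell E, polyFun ((-ν) • curlP (divEpsP P)) x * polyFun q x) -
      (∫ x in cell E, g x * polyFun q x) + (∫ x in cell E, g x ^ 2) +
      ν ^ 2 / 3 * ∫ x in cell E, polyFun (curlP (divEpsP P)) x ^ 2 := by
    rw [← integral_const_mul, ← integral_add i1 i2, ← integral_sub (i1.fun_add i2) i3,
      ← integral_add ((i1.fun_add i2).fun_sub i3) i4,
      ← integral_add (((i1.fun_add i2).fun_sub i3).fun_add i4) (i5.const_mul _)]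
    refine integral_nonneg fun x => ?_
    simp only [Pi.zero_apply, polyFun_smul]
    generalize polyFun q x = v
    generalize polyFun (curlP (divEpsP P)) x = d
    nlinarith [sq_nonneg (3 * v - 2 * (ν * d)), sq_nonneg (v - 2 * g x)]
  have h := delta_mul_integral_curl_divEps_le hν hδ hδ' hP
  have h' := mul_le_mul_of_nonneg_left h hν.le
  have k' := mul_nonneg hδ key
  nlinarith

/-! ### Dependence of the element integrals on time. -/

/-- `f` agrees on `s`, at each time, with a jointly continuous function of time and space. -/
def ContinuousInTimeOn (s : Set Pt) (f : ℝ → Pt → ℝ) : Prop :=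
  ∃ F : ℝ → Pt → ℝ, Continuous (Function.uncurry F) ∧ ∀ t, Set.EqOn (f t) (F t) s

namespace ContinuousInTimeOn

variable {s : Set Pt} {f g : ℝ → Pt → ℝ}

theorem mul (hf : ContinuousInTimeOn s f) (hg : ContinuousInTimeOn s g) :
    ContinuousInTimeOn s (fun t x => f t x * g t x) := by
  obtain ⟨F, hF, hfF⟩ := hf
  obtain ⟨G, hG, hgG⟩ := hg
  exact ⟨fun t x => F t x * G t x, hF.mul hG, fun t x hx => by simp only [hfF t hx, hgG t hx]⟩

theorem sum {ι : Type*} {r : Finset ι} {f : ι → ℝ → Pt → ℝ}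
    (hf : ∀ i ∈ r, ContinuousInTimeOn s (f i)) :
    ContinuousInTimeOn s (fun t x => ∑ i ∈ r, f i t x) := by
  choose! F hF hfF using hf
  refine ⟨fun t x => ∑ i ∈ r, F i t x, continuous_finsetSum r hF, fun t x hx => ?_⟩
  exact Finset.sum_congr rfl fun i hi => hfF i hi t hx

theorem integrableOn_cell {E : Finset Pt} (hf : ContinuousInTimeOn (cell E) f) (t : ℝ) :
    IntegrableOn (f t) (cell E) := by
  obtain ⟨F, hF, hfF⟩ := hf
  exact (integrableOn_congr_fun (hfF t) (measurableSet_cell E)).2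
    (VortStab.integrableOn_cell (hF.comp (Continuous.prodMk_right t)) E)

/-- The open triangle may be replaced by its closure, up to a null set; there the continuous
extension is integrated over a compact set. -/
theorem continuous_integral {E : Finset Pt} (hf : ContinuousInTimeOn (cell E) f) :
    Continuous fun t => ∫ x in cell E, f t x := by
  obtain ⟨F, hF, hfF⟩ := hf
  have : (fun t => ∫ x in cell E, f t x) =
      fun t => ∫ x in convexHull ℝ (E : Set Pt), F t x := by
    ext t
    rw [setIntegral_congr_fun (measurableSet_cell E) (hfF t), integral_cell_eq]
  rw [this]
  exact continuous_parametric_integral_of_continuous hF (isCompact_hull E)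

/-- On a space-time cell of finite measure g is integrable and the other factor is bounded; Fubini
gives integrability in time. -/
theorem integrableOn_integral_mul {E : Finset Pt} (hf : ContinuousInTimeOn (cell E) f)
    {α β : ℝ} (hg : MemLp (fun z : ℝ × Pt => g z.1 z.2) 2
      ((volume.restrict (Set.Ioo α β)).prod (volume.restrict (cell E)))) :
    IntegrableOn (fun t => ∫ x in cell E, g t x * f t x) (Set.Ioo α β) := by
  obtain ⟨F, hF, hfF⟩ := hf
  have : IsFiniteMeasure (volume.restrict (cell E)) :=
    ⟨by
      rw [Measure.restrict_apply_univ]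
      exact (measure_mono (cell_subset E)).trans_lt (isCompact_hull E).measure_lt_top⟩
  have h1 : (fun t => ∫ x in cell E, g t x * f t x) =
      fun t => ∫ x in cell E, g t x * F t x := by
    ext t
    exact setIntegral_congr_fun (measurableSet_cell E) fun x hx => by simp only [hfF t hx]
  rw [h1]
  obtain ⟨B, hB⟩ := ((isCompact_Icc (a := α) (b := β)).prod
    (isCompact_hull E)).exists_bound_of_continuousOn hF.continuousOn
  refine Integrable.integral_prod_left (f := fun z : ℝ × Pt => g z.1 z.2 * F z.1 z.2)
    ((hg.integrable (by norm_num)).mul_bdd (c := B) hF.aestronglyMeasurable ?_)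
  rw [Measure.prod_restrict]
  filter_upwards [ae_restrict_mem (measurableSet_Ioo.prod (measurableSet_cell E))] with z hz
  exact hB z ⟨Set.Ioo_subset_Icc_self hz.1, cell_subset E hz.2⟩

end ContinuousInTimeOn

theorem curlP_add (P Q : PolyPair) : curlP (P + Q) = curlP P + curlP Q := by
  simp only [curlP, Pi.add_apply, map_add]; ring

theorem curlP_smul (c : ℝ) (P : PolyPair) : curlP (c • P) = c • curlP P := by
  simp only [curlP, Pi.smul_apply, Derivation.map_smul, smul_sub]

theorem epsP_affine (A B : PolyPair) (t : ℝ) (i j : Fin 2) :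
    epsP (A + t • B) i j = epsP A i j + t • epsP B i j := by
  simp only [epsP, Pi.add_apply, Pi.smul_apply, map_add, Derivation.map_smul]
  module

theorem divEpsP_affine (A B : PolyPair) (t : ℝ) :
    divEpsP (A + t • B) = divEpsP A + t • divEpsP B := by
  ext1 i
  simp only [divEpsP, epsP_affine, Pi.add_apply, Pi.smul_apply, map_add, Derivation.map_smul,
    Finset.sum_add_distrib, Finset.smul_sum]

theorem convP_affine (A B : PolyPair) (t : ℝ) :
    convP (A + t • B) (A + t • B) =
      convP A A + t • (convP A B + convP B A) + t ^ 2 • convP B B := by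
  ext1 i
  simp only [convP, Fin.sum_univ_two, Pi.add_apply, Pi.smul_apply, map_add,
    MvPolynomial.smul_eq_C_mul, MvPolynomial.pderiv_C_mul, map_pow]
  ring

/-- The affine function `a + t b` of time. -/
def affineInTime (a b : Pt → Pt) (t : ℝ) : Pt → Pt := a + t • b

section Affine

variable {a b : Pt → Pt}

theorem hasDerivAt_affineInTime (t : ℝ) (x : Pt) :
    HasDerivAt (fun s => affineInTime a b s x) (b x) t := by
  simpa [affineInTime] using ((hasDerivAt_id t).smul_const (b x)).const_add (a x)

theorem dt_affineInTime (t : ℝ) : dt (affineInTime a b) t = b := by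
  ext1 x
  exact (hasDerivAt_affineInTime t x).deriv

variable {s : Set Pt} {A B : PolyPair}

theorem affineInTime_eqOn (ha : Set.EqOn a (polyVec A) s) (hb : Set.EqOn b (polyVec B) s) (t : ℝ) :
    Set.EqOn (affineInTime a b t) (polyVec (A + t • B)) s := fun x hx => by
  ext i
  simp [affineInTime, ha hx, hb hx]

theorem vort_affine_eqOn (hs : IsOpen s) (ha : Set.EqOn a (polyVec A) s)
    (hb : Set.EqOn b (polyVec B) s) (t : ℝ) :
    Set.EqOn (vort (affineInTime a b) (affineInTime a b) t)
      (polyFun (curlP (B + convP (A + t • B) (A + t • B)))) s := by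
  refine curl_eqOn hs fun x hx => ?_
  have h := affineInTime_eqOn ha hb t
  simp only [dt_affineInTime, conv_eqOn hs h h hx, hb hx]
  ext i
  simp

theorem viscous_affine_eqOn (hs : IsOpen s) (ha : Set.EqOn a (polyVec A) s)
    (hb : Set.EqOn b (polyVec B) s) (ν t : ℝ) :
    Set.EqOn (curl (fun y => -(ν • divEps (affineInTime a b t) y)))
      (polyFun ((-ν) • curlP (divEpsP (A + t • B)))) s := by
  rw [← curlP_smul]
  refine curl_eqOn hs fun x hx => ?_
  simp only [divEps_eqOn hs (affineInTime_eqOn ha hb t) hx]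
  ext i
  simp

theorem continuousInTimeOn_vort (hs : IsOpen s) (ha : Set.EqOn a (polyVec A) s)
    (hb : Set.EqOn b (polyVec B) s) :
    ContinuousInTimeOn s (vort (affineInTime a b) (affineInTime a b)) := by
  refine ⟨fun t => polyFun (curlP (B + convP (A + t • B) (A + t • B))), ?_,
    vort_affine_eqOn hs ha hb⟩
  simp only [convP_affine, curlP_add, curlP_smul, Function.uncurry_def, polyFun_add,
    polyFun_smul]
  fun_prop

theorem continuousInTimeOn_viscous (hs : IsOpen s) (ha : Set.EqOn a (polyVec A) s)
    (hb : Set.EqOn b (polyVec B) s) (ν : ℝ) :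
    ContinuousInTimeOn s (fun t => curl (fun y => -(ν • divEps (affineInTime a b t) y))) := by
  refine ⟨fun t => polyFun ((-ν) • curlP (divEpsP (A + t • B))), ?_,
    viscous_affine_eqOn hs ha hb ν⟩
  simp only [divEpsP_affine, curlP_add, curlP_smul, Function.uncurry_def, polyFun_add,
    polyFun_smul]
  fun_prop

theorem continuousInTimeOn_eps (hs : IsOpen s) (ha : Set.EqOn a (polyVec A) s)
    (hb : Set.EqOn b (polyVec B) s) (i j : Fin 2) :
    ContinuousInTimeOn s (fun t => eps (affineInTime a b t) i j) := by
  refine ⟨fun t => polyFun (epsP (A + t • B) i j), ?_,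
    fun t => eps_eqOn hs (affineInTime_eqOn ha hb t) i j⟩
  simp only [epsP_affine, Function.uncurry_def, polyFun_add, polyFun_smul]
  fun_prop

theorem continuousInTimeOn_epsSq (hs : IsOpen s) (ha : Set.EqOn a (polyVec A) s)
    (hb : Set.EqOn b (polyVec B) s) :
    ContinuousInTimeOn s (fun t x => ∑ i, ∑ j,
      eps (affineInTime a b t) i j x * eps (affineInTime a b t) i j x) :=
  .sum fun i _ => .sum fun j _ =>
    (continuousInTimeOn_eps hs ha hb i j).mul (continuousInTimeOn_eps hs ha hb i j)

end Affine

/-! ### The stabilised form on the discrete kernel. -/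

section Spaces

variable {M : Mesh Ω} {k : ℕ} {S : FESpaces M k}

/-- The divergence of v is itself, almost everywhere, an element of Q_h, hence an admissible
multiplier, and its square integrates to zero. -/
theorem FESpaces.divg_eq_zero {v : Pt → Pt} (hv : v ∈ S.Zh) :
    divg v =ᵐ[volume.restrict Ω] 0 := by
  obtain ⟨q, hq, hvq⟩ := S.div_mem v hv.1
  have h0 := hv.2 q hq
  have h1 : ∫ x in Ω, q x ^ 2 = 0 := by
    rw [← h0, formB]
    refine integral_congr_ae ?_
    filter_upwards [hvq] with x hx
    rw [hx, sq]
  have h2 := (integral_eq_zero_iff_of_nonneg (fun x => sq_nonneg (q x))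
    (MemLp.integrable_sq (S.Qh_sub q hq).1)).1 h1
  filter_upwards [hvq, h2] with x hx hx2
  rw [hx]
  simpa using hx2

theorem FESpaces.zero_mem_Zh : (0 : Pt → Pt) ∈ S.Zh :=
  ⟨S.Vh.zero_mem, fun q _ => by simp [formB, divg, pd]⟩

theorem FESpaces.affineInTime_mem {a b : Pt → Pt} (ha : a ∈ S.Vh) (hb : b ∈ S.Vh) (t : ℝ) :
    affineInTime a b t ∈ S.Vh :=
  S.Vh.add_mem ha (S.Vh.smul_mem t hb)

theorem FESpaces.pw {v : Pt → Pt} (hv : v ∈ S.Vh) : M.PW v :=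
  (S.le_poly v hv).pw (S.Vh_sub v hv)

theorem FESpaces.exists_repr {v : Pt → Pt} (hv : v ∈ S.Vh) : ∃ P, M.Repr (k + 3) v P :=
  (S.le_poly v hv).exists_repr

/-- Classical derivatives are linear only where the fields are differentiable, so the sum is taken
on the open triangles, which fill Ω up to a null set. -/
theorem FESpaces.divg_affineInTime_eq_zero (hΩ : IsPolygonalDomain Ω) {a b : Pt → Pt}
    (ha : a ∈ S.Zh) (hb : b ∈ S.Zh) (t : ℝ) :
    divg (affineInTime a b t) =ᵐ[volume.restrict Ω] 0 := by
  have hreg : ∀ᵐ x ∂(volume.restrict Ω), x ∈ ⋃ E ∈ M.cells, cell E := by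
    have h := (M.iUnion_cell_ae_eq hΩ).mem_iff
    filter_upwards [ae_restrict_of_ae h, ae_restrict_mem hΩ.isOpen.measurableSet] with x hx hxΩ
    exact hx.2 hxΩ
  filter_upwards [FESpaces.divg_eq_zero ha, FESpaces.divg_eq_zero hb, hreg] with x h1 h2 hx
  obtain ⟨E, hE, hxE⟩ := Set.mem_iUnion₂.1 hx
  obtain ⟨A, hA⟩ := FESpaces.exists_repr ha.1
  obtain ⟨B, hB⟩ := FESpaces.exists_repr hb.1
  have hA := (hA E hE).2
  have hB := (hB E hE).2
  rw [divg_eqOn (isOpen_cell E) hA hxE] at h1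
  rw [divg_eqOn (isOpen_cell E) hB hxE] at h2
  rw [divg_eqOn (isOpen_cell E) (affineInTime_eqOn hA hB t) hxE]
  simp only [Pi.add_apply, Pi.smul_apply, map_add, Derivation.map_smul, Finset.sum_add_distrib,
    ← Finset.smul_sum, polyFun_add, polyFun_smul, h1, h2]
  simp

theorem FESpaces.formC_affineInTime (hΩ : IsPolygonalDomain Ω) {a b : Pt → Pt}
    (ha : a ∈ S.Zh) (hb : b ∈ S.Zh) (t : ℝ) :
    formC Ω (affineInTime a b t) (affineInTime a b t) (affineInTime a b t) = 0 :=
  have h := FESpaces.affineInTime_mem ha.1 hb.1 t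
  formC_self_eq_zero hΩ (S.Vh_sub _ h) (S.le_poly _ h) (FESpaces.divg_affineInTime_eq_zero hΩ ha hb t)

theorem FESpaces.formA_affineInTime (hΩ : IsPolygonalDomain Ω) {a b : Pt → Pt}
    (ha : a ∈ S.Vh) (hb : b ∈ S.Vh) (t : ℝ) :
    formA Ω (affineInTime a b t) (affineInTime a b t) = ∑ E ∈ M.cells, ∫ x in cell E, ∑ i, ∑ j,
      eps (affineInTime a b t) i j x * eps (affineInTime a b t) i j x := by
  obtain ⟨A, hA⟩ := FESpaces.exists_repr ha
  obtain ⟨B, hB⟩ := FESpaces.exists_repr hb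
  exact M.integral_eq_sum hΩ fun E hE =>
    (continuousInTimeOn_epsSq (isOpen_cell E) (hA E hE).2 (hB E hE).2).integrableOn_cell t

theorem FESpaces.continuous_Kstab (hΩ : IsPolygonalDomain Ω) {a b : Pt → Pt}
    (ha : a ∈ S.Zh) (hb : b ∈ S.Zh) (ν : ℝ) (δ : Finset Pt → ℝ) :
    Continuous (Kstab M ν δ (affineInTime a b) (affineInTime a b) (affineInTime a b)
      (affineInTime a b)) := by
  obtain ⟨A, hA⟩ := FESpaces.exists_repr ha.1
  obtain ⟨B, hB⟩ := FESpaces.exists_repr hb.1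
  have hv := fun E hE =>
    continuousInTimeOn_vort (isOpen_cell E) (hA E hE).2 (hB E hE).2
  have h1 : Continuous fun t => formA Ω (affineInTime a b t) (affineInTime a b t) := by
    simp only [FESpaces.formA_affineInTime hΩ ha.1 hb.1]
    exact continuous_finsetSum _ fun E hE =>
      (continuousInTimeOn_epsSq (isOpen_cell E) (hA E hE).2 (hB E hE).2).continuous_integral
  -- The convective form is continuous because it is identically zero.
  have h2 : Continuous fun t => formC Ω (affineInTime a b t) (affineInTime a b t)
      (affineInTime a b t) := by
    simp only [FESpaces.formC_affineInTime hΩ ha hb]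
    exact continuous_const
  have h3 : Continuous (stabC M δ (affineInTime a b) (affineInTime a b) (affineInTime a b)
      (affineInTime a b)) :=
    continuous_finsetSum _ fun E hE => continuous_const.mul
      ((hv E hE).mul (hv E hE)).continuous_integral
  have h4 : Continuous (stabL M ν δ (affineInTime a b) (affineInTime a b) (affineInTime a b)) :=
    continuous_finsetSum _ fun E hE => continuous_const.mul
      ((continuousInTimeOn_viscous (isOpen_cell E) (hA E hE).2 (hB E hE).2 ν).mul
        (hv E hE)).continuous_integral
  have h5 : Continuous (stabJ M (affineInTime a b) (affineInTime a b) (affineInTime a b)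
      (affineInTime a b)) :=
    continuous_stabJ_affine (FESpaces.pw ha.1) (FESpaces.pw hb.1)
      (S.Vh_sub a ha.1).continuous.measurable (S.Vh_sub b hb.1).continuous.measurable
  exact ((((h1.const_mul ν).add h2).add h3).add h4).add h5

/-- Coercivity of the stabilised form, up to the load. -/
theorem FESpaces.Kstab_coercivity (hΩ : IsPolygonalDomain Ω) {a b : Pt → Pt}
    (ha : a ∈ S.Zh) (hb : b ∈ S.Zh) {ν : ℝ} (hν : 0 < ν) {δ : Finset Pt → ℝ}
    (hδ : ∀ E ∈ M.cells, 0 ≤ δ E ∧ δ E ≤ diamE E ^ 4 / (ν * invConst (k + 2) E ^ 2))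
    {g : ℝ → Pt → ℝ} {t : ℝ} (hg : ∀ E ∈ M.cells, MemLp (g t) 2 (volume.restrict (cell E))) :
    -(∑ E ∈ M.cells, δ E * ∫ x in cell E, g t x ^ 2) ≤
      Kstab M ν δ (affineInTime a b) (affineInTime a b) (affineInTime a b) (affineInTime a b) t -
        stabF M δ g (affineInTime a b) (affineInTime a b) t := by
  obtain ⟨A, hA⟩ := FESpaces.exists_repr ha.1
  obtain ⟨B, hB⟩ := FESpaces.exists_repr hb.1
  have hJ := stabJ_self_nonneg M (affineInTime a b) (affineInTime a b) t
  have hcell : ∀ E ∈ M.cells, -(δ E * ∫ x in cell E, g t x ^ 2) ≤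
      ν * (∫ x in cell E, ∑ i, ∑ j,
        eps (affineInTime a b t) i j x * eps (affineInTime a b t) i j x) +
      δ E * (∫ x in cell E, vort (affineInTime a b) (affineInTime a b) t x *
        vort (affineInTime a b) (affineInTime a b) t x) +
      δ E * (∫ x in cell E, curl (fun y => -(ν • divEps (affineInTime a b t) y)) x *
        vort (affineInTime a b) (affineInTime a b) t x) -
      δ E * ∫ x in cell E, g t x * vort (affineInTime a b) (affineInTime a b) t x := by
    intro E hE
    obtain ⟨dA, hA⟩ := hA E hE
    obtain ⟨dB, hB⟩ := hB E hE
    have hdeg : ∀ i, ((A E + t • B E) i).totalDegree ≤ k + 2 + 1 := fun i =>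
      (MvPolynomial.totalDegree_add _ _).trans
        (max_le (dA i) ((MvPolynomial.totalDegree_smul_le _ _).trans (dB i)))
    have h := cell_coercivity hν (hδ E hE).1 (hδ E hE).2 hdeg
      (curlP (B E + convP (A E + t • B E) (A E + t • B E))) (hg E hE)
    have hs := isOpen_cell E
    have hm := measurableSet_cell E
    have e1 := fun x hx i j => eps_eqOn hs (affineInTime_eqOn hA hB t) i j (x := x) hx
    have e2 := fun x hx => vort_affine_eqOn hs hA hB t (x := x) hx
    have e3 := fun x hx => viscous_affine_eqOn hs hA hB ν t (x := x) hx
    refine h.trans (le_of_eq ?_)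
    congr 1
    · congr 1
      · congr 1
        · congr 1
          exact setIntegral_congr_fun hm fun x hx => by simp only [e1 x hx]
        · congr 1
          exact setIntegral_congr_fun hm fun x hx => by simp only [e2 x hx]
      · congr 1
        exact setIntegral_congr_fun hm fun x hx => by simp only [e2 x hx, e3 x hx]
    · congr 1
      exact setIntegral_congr_fun hm fun x hx => by simp only [e2 x hx]
  have hsum := Finset.sum_le_sum hcell
  simp only [Finset.sum_neg_distrib, Finset.sum_sub_distrib, Finset.sum_add_distrib,
    ← Finset.mul_sum] at hsum
  rw [Kstab, FESpaces.formC_affineInTime hΩ ha hb, FESpaces.formA_affineInTime hΩ ha.1 hb.1]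
  simp only [stabC, stabL, stabF]
  linarith

theorem FESpaces.integrableOn_stabF {a b : Pt → Pt}
    (ha : a ∈ S.Vh) (hb : b ∈ S.Vh) (δ : Finset Pt → ℝ) {g : ℝ → Pt → ℝ} {α β : ℝ}
    (hg : ∀ E ∈ M.cells, MemLp (fun z : ℝ × Pt => g z.1 z.2) 2
      ((volume.restrict (Set.Ioo α β)).prod (volume.restrict (cell E)))) :
    IntegrableOn (stabF M δ g (affineInTime a b) (affineInTime a b)) (Set.Ioo α β) := by
  obtain ⟨A, hA⟩ := FESpaces.exists_repr ha
  obtain ⟨B, hB⟩ := FESpaces.exists_repr hb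
  exact integrable_finsetSum _ fun E hE => Integrable.const_mul
    ((continuousInTimeOn_vort (isOpen_cell E) (hA E hE).2 (hB E hE).2).integrableOn_integral_mul
      (hg E hE)) _

end Spaces

/-! ### The `L²` inner product on the discrete space -/

theorem ip_self_nonneg (u : Pt → Pt) : 0 ≤ ip Ω u u :=
  integral_nonneg fun _ => real_inner_self_nonneg

theorem ip_self_eq (u : Pt → Pt) : ip Ω u u = ∫ x in Ω, ‖u x‖ ^ 2 := by
  simp only [ip, real_inner_self_eq_norm_sq]

@[simp] theorem ip_zero_right (u : Pt → Pt) : ip Ω u 0 = 0 := by simp [ip]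

section Inner

variable {M : Mesh Ω} {k : ℕ} {S : FESpaces M k}

theorem FESpaces.memLp (hΩ : IsPolygonalDomain Ω) {u : Pt → Pt} (hu : u ∈ S.Vh) :
    MemLp u 2 (volume.restrict Ω) :=
  ((S.Vh_sub u hu).continuous.memLp_of_hasCompactSupport
    ((S.Vh_sub u hu).hasCompactSupport hΩ)).restrict Ω

theorem FESpaces.integrableOn_inner (hΩ : IsPolygonalDomain Ω) {u v : Pt → Pt} (hu : u ∈ S.Vh)
    (hv : v ∈ S.Vh) : IntegrableOn (fun x => inner ℝ (u x) (v x)) Ω := by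
  refine (Continuous.integrable_of_hasCompactSupport
    ((S.Vh_sub u hu).continuous.inner (S.Vh_sub v hv).continuous) ?_).integrableOn
  exact ((S.Vh_sub u hu).hasCompactSupport hΩ).mono fun x hx h => hx (by simp [h])

theorem FESpaces.ip_affineInTime (hΩ : IsPolygonalDomain Ω) {a b : Pt → Pt} (ha : a ∈ S.Vh)
    (hb : b ∈ S.Vh) (t : ℝ) :
    ip Ω (affineInTime a b t) (affineInTime a b t) =
      ip Ω a a + 2 * t * ip Ω a b + t ^ 2 * ip Ω b b := by
  have h1 := FESpaces.integrableOn_inner hΩ ha ha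
  have h2 := FESpaces.integrableOn_inner hΩ ha hb
  have h3 := FESpaces.integrableOn_inner hΩ hb hb
  unfold ip
  rw [← integral_const_mul, ← integral_const_mul, ← integral_add h1 (h2.const_mul _),
    ← integral_add (h1.fun_add (h2.const_mul _)) (h3.const_mul _)]
  refine integral_congr_ae (.of_forall fun x => ?_)
  simp only [affineInTime, Pi.add_apply, Pi.smul_apply, inner_add_left, inner_add_right,
    real_inner_smul_left, real_inner_smul_right, real_inner_comm (b x) (a x)]
  ring

theorem FESpaces.ip_slope_affineInTime (hΩ : IsPolygonalDomain Ω) {a b : Pt → Pt}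
    (ha : a ∈ S.Vh) (hb : b ∈ S.Vh) (t : ℝ) :
    ip Ω b (affineInTime a b t) = ip Ω a b + t * ip Ω b b := by
  have h2 := FESpaces.integrableOn_inner hΩ ha hb
  have h3 := FESpaces.integrableOn_inner hΩ hb hb
  unfold ip
  rw [← integral_const_mul, ← integral_add h2 (h3.const_mul _)]
  refine integral_congr_ae (.of_forall fun x => ?_)
  simp only [affineInTime, Pi.add_apply, Pi.smul_apply, inner_add_right,
    real_inner_smul_right, real_inner_comm (b x) (a x)]

theorem FESpaces.ip_sub_left (hΩ : IsPolygonalDomain Ω) {p q : Pt → Pt}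
    (hp : p ∈ S.Vh) (hq : q ∈ S.Vh) :
    ip Ω (p - q) p = 1 / 2 * ip Ω p p - 1 / 2 * ip Ω q q + 1 / 2 * ip Ω (p - q) (p - q) := by
  have h1 := FESpaces.integrableOn_inner hΩ hp hp
  have h2 := FESpaces.integrableOn_inner hΩ hq hq
  have h3 := FESpaces.integrableOn_inner hΩ (S.Vh.sub_mem hp hq) (S.Vh.sub_mem hp hq)
  unfold ip
  rw [← integral_const_mul, ← integral_const_mul, ← integral_const_mul,
    ← integral_sub (h1.const_mul _) (h2.const_mul _),
    ← integral_add ((h1.const_mul _).sub' (h2.const_mul _)) (h3.const_mul _)]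
  refine integral_congr_ae (.of_forall fun x => ?_)
  simp only [Pi.sub_apply, inner_sub_left, inner_sub_right, real_inner_comm (p x) (q x)]
  ring

/-- Expanding ‖p - 2q‖² ≥ 0. This passes from the energy before a node to the energy after it, at
the price of the jump. -/
theorem FESpaces.ip_self_le (hΩ : IsPolygonalDomain Ω) {p q : Pt → Pt}
    (hp : p ∈ S.Vh) (hq : q ∈ S.Vh) :
    ip Ω p p ≤ 2 * ip Ω q q + 2 * ip Ω (p - q) (p - q) := by
  have h1 := FESpaces.integrableOn_inner hΩ hp hp
  have h2 := FESpaces.integrableOn_inner hΩ hq hq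
  have h3 := FESpaces.integrableOn_inner hΩ (S.Vh.sub_mem hp hq) (S.Vh.sub_mem hp hq)
  unfold ip
  rw [← integral_const_mul, ← integral_const_mul,
    ← integral_add (h2.const_mul _) (h3.const_mul _)]
  refine integral_mono h1 ((h2.const_mul _).fun_add (h3.const_mul _)) fun x => ?_
  have := real_inner_self_nonneg (x := p x - (2 : ℝ) • q x)
  simp only [Pi.sub_apply, inner_sub_left, inner_sub_right, real_inner_comm (p x) (q x),
    real_inner_smul_left, real_inner_smul_right] at this ⊢
  linarith

/-- Expanding ‖p - q/2‖² ≥ 0. Applied with p the initial datum; the weight 1/4 is half of what the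
telescoped energy holds at time 0. -/
theorem FESpaces.ip_le (hΩ : IsPolygonalDomain Ω) {p q : Pt → Pt}
    (hp : p ∈ S.Vh) (hq : q ∈ S.Vh) : ip Ω p q ≤ ip Ω p p + 1 / 4 * ip Ω q q := by
  have h1 := FESpaces.integrableOn_inner hΩ hp hp
  have h2 := FESpaces.integrableOn_inner hΩ hq hq
  have h3 := FESpaces.integrableOn_inner hΩ hp hq
  unfold ip
  rw [← integral_const_mul, ← integral_add h1 (h2.const_mul _)]
  refine integral_mono h3 (h1.fun_add (h2.const_mul _)) fun x => ?_
  have := real_inner_self_nonneg (x := p x - (1 / 2 : ℝ) • q x)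
  simp only [inner_sub_left, inner_sub_right, real_inner_comm (p x) (q x),
    real_inner_smul_left, real_inner_smul_right] at this ⊢
  linarith

/-- The energy is a quadratic in time with leading coefficient ‖b‖² ≥ 0, hence convex. The term `k3`
is the exact defect of the chord inequality multiplied by r - s. -/
theorem FESpaces.ip_affineInTime_le (hΩ : IsPolygonalDomain Ω) {a b : Pt → Pt} (ha : a ∈ S.Vh)
    (hb : b ∈ S.Vh) {s t r B : ℝ} (ht : t ∈ Set.Ioo s r)
    (h1 : ip Ω (affineInTime a b s) (affineInTime a b s) ≤ B)
    (h2 : ip Ω (affineInTime a b r) (affineInTime a b r) ≤ B) :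
    ip Ω (affineInTime a b t) (affineInTime a b t) ≤ B := by
  rw [FESpaces.ip_affineInTime hΩ ha hb] at h1 h2 ⊢
  have h0 := ip_self_nonneg (Ω := Ω) b
  obtain ⟨hs, hr⟩ := ht
  have k1 := mul_le_mul_of_nonneg_left h1 (sub_nonneg.2 hr.le)
  have k2 := mul_le_mul_of_nonneg_left h2 (sub_nonneg.2 hs.le)
  have k3 : 0 ≤ ip Ω b b * ((r - s) * ((r - t) * (t - s))) :=
    mul_nonneg h0 (mul_nonneg (by linarith) (mul_nonneg (by linarith) (by linarith)))
  have hrs : 0 < r - s := by linarith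
  refine le_of_mul_le_mul_left ?_ hrs
  linear_combination k1 + k2 + k3

theorem FESpaces.integral_ip_slope (hΩ : IsPolygonalDomain Ω) {a b : Pt → Pt} (ha : a ∈ S.Vh)
    (hb : b ∈ S.Vh) {s r : ℝ} (hsr : s ≤ r) :
    ∫ t in Set.Ioo s r, ip Ω b (affineInTime a b t) =
      1 / 2 * (ip Ω (affineInTime a b r) (affineInTime a b r) -
        ip Ω (affineInTime a b s) (affineInTime a b s)) := by
  simp only [FESpaces.ip_slope_affineInTime hΩ ha hb, FESpaces.ip_affineInTime hΩ ha hb]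
  rw [← integral_Ioc_eq_integral_Ioo, ← intervalIntegral.integral_of_le hsr,
    intervalIntegral.integral_add (by simp)
    (Continuous.intervalIntegrable (by fun_prop) _ _), intervalIntegral.integral_mul_const,
    integral_id, intervalIntegral.integral_const, smul_eq_mul]
  ring

theorem FESpaces.continuous_ip_slope (hΩ : IsPolygonalDomain Ω) {a b : Pt → Pt} (ha : a ∈ S.Vh)
    (hb : b ∈ S.Vh) : Continuous fun t => ip Ω b (affineInTime a b t) := by
  simp only [FESpaces.ip_slope_affineInTime hΩ ha hb]
  fun_prop

end Inner

/-! ### Integrability and bounds for the load. -/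

theorem ae_memLp_prodMk {X Y F : Type*} [MeasurableSpace X] [MeasurableSpace Y]
    [NormedAddCommGroup F] {μ : Measure X} {ν : Measure Y} [SFinite μ] [SFinite ν]
    {f : X × Y → F} (hf : MemLp f 2 (μ.prod ν)) :
    ∀ᵐ x ∂μ, MemLp (fun y => f (x, y)) 2 ν := by
  have h := (memLp_two_iff_integrable_sq_norm hf.1).1 hf
  filter_upwards [h.prod_right_ae, hf.1.prodMk_left] with x hx hm
  exact (memLp_two_iff_integrable_sq_norm hm).2 hx

section Load

variable {M : Mesh Ω} {k : ℕ} {S : FESpaces M k} {f : ℝ → Pt → Pt} {s r : ℝ}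

theorem integrableOn_integral_normSq (hf : MemLp (fun z : ℝ × Pt => f z.1 z.2) 2
      ((volume.restrict (Set.Ioo s r)).prod (volume.restrict Ω))) :
    IntegrableOn (fun t => ∫ x in Ω, ‖f t x‖ ^ 2) (Set.Ioo s r) :=
  Integrable.integral_prod_left ((memLp_two_iff_integrable_sq_norm hf.1).1 hf)

theorem FESpaces.integrableOn_ip_load (hΩ : IsPolygonalDomain Ω) {a b : Pt → Pt}
    (ha : a ∈ S.Vh) (hb : b ∈ S.Vh) (hf : MemLp (fun z : ℝ × Pt => f z.1 z.2) 2
      ((volume.restrict (Set.Ioo s r)).prod (volume.restrict Ω))) :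
    IntegrableOn (fun t => ip Ω (f t) (affineInTime a b t)) (Set.Ioo s r) := by
  have hfin : IsFiniteMeasure (volume.restrict Ω) :=
    ⟨by
      rw [Measure.restrict_apply_univ]
      exact (measure_mono subset_closure).trans_lt hΩ.isCompact_closure.measure_lt_top⟩
  have hac := (S.Vh_sub a ha).continuous
  have hbc := (S.Vh_sub b hb).continuous
  have hW : Continuous fun z : ℝ × Pt => affineInTime a b z.1 z.2 := by
    simp only [affineInTime, Pi.add_apply, Pi.smul_apply]
    fun_prop
  obtain ⟨B, hB⟩ := ((isCompact_Icc (a := s) (b := r)).prod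
    hΩ.isCompact_closure).exists_bound_of_continuousOn hW.continuousOn
  refine Integrable.integral_prod_left
    (f := fun z : ℝ × Pt => inner ℝ (f z.1 z.2) (affineInTime a b z.1 z.2)) ?_
  refine Integrable.mono' ((hf.integrable (by norm_num)).norm.mul_const B)
    (hf.1.inner hW.aestronglyMeasurable) ?_
  rw [Measure.prod_restrict]
  filter_upwards [ae_restrict_mem (measurableSet_Ioo.prod hΩ.isOpen.measurableSet)] with z hz
  exact (norm_inner_le_norm _ _).trans (mul_le_mul_of_nonneg_left
    (hB z ⟨Set.Ioo_subset_Icc_self hz.1, subset_closure hz.2⟩) (norm_nonneg _))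

/-- Young's inequality pq ≤ αp² + q²/(4α) at almost every time. The parameter is left free so that
the energy term can later be made a small fraction of the maximum. -/
theorem FESpaces.integral_ip_load_le (hΩ : IsPolygonalDomain Ω) {a b : Pt → Pt}
    (ha : a ∈ S.Vh) (hb : b ∈ S.Vh) (hf : MemLp (fun z : ℝ × Pt => f z.1 z.2) 2
      ((volume.restrict (Set.Ioo s r)).prod (volume.restrict Ω))) (hsr : s ≤ r) {α B : ℝ}
    (hα : 0 < α)
    (hB : ∀ t ∈ Set.Ioo s r, ip Ω (affineInTime a b t) (affineInTime a b t) ≤ B) :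
    ∫ t in Set.Ioo s r, ip Ω (f t) (affineInTime a b t) ≤
      α * (∫ t in Set.Ioo s r, ∫ x in Ω, ‖f t x‖ ^ 2) + (r - s) * (B / (4 * α)) := by
  have h1 := FESpaces.integrableOn_ip_load hΩ ha hb hf
  have h2 := integrableOn_integral_normSq hf
  have hc : IntegrableOn (fun _ : ℝ => B / (4 * α)) (Set.Ioo s r) := by simp
  have e : (r - s) * (B / (4 * α)) = ∫ t in Set.Ioo s r, B / (4 * α) := by
    rw [setIntegral_const, Measure.real, Real.volume_Ioo,
      ENNReal.toReal_ofReal (sub_nonneg.2 hsr), smul_eq_mul]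
  rw [e, ← integral_const_mul, ← integral_add (h2.const_mul _) hc]
  refine integral_mono_ae h1 ((h2.const_mul _).fun_add hc) ?_
  filter_upwards [ae_memLp_prodMk hf, ae_restrict_mem measurableSet_Ioo] with t ht htI
  have hW := FESpaces.affineInTime_mem ha hb t
  have i1 := (memLp_two_iff_integrable_sq_norm ht.1).1 ht
  have i2 := FESpaces.integrableOn_inner hΩ hW hW
  have i3 : IntegrableOn (fun x => inner ℝ (f t x) (affineInTime a b t x)) Ω := by
    refine Integrable.mono' (i1.fun_add i2) (ht.1.inner (FESpaces.memLp hΩ hW).1)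
      (.of_forall fun x => ?_)
    refine (norm_inner_le_norm _ _).trans ?_
    rw [real_inner_self_eq_norm_sq]
    nlinarith [sq_nonneg (‖f t x‖ - ‖affineInTime a b t x‖), sq_nonneg (‖f t x‖),
      sq_nonneg (‖affineInTime a b t x‖)]
  have key : ip Ω (f t) (affineInTime a b t) ≤
      α * (∫ x in Ω, ‖f t x‖ ^ 2) +
        1 / (4 * α) * ip Ω (affineInTime a b t) (affineInTime a b t) := by
    unfold ip
    rw [← integral_const_mul, ← integral_const_mul,
      ← integral_add (i1.const_mul _) (i2.const_mul _)]
    refine integral_mono i3 ((i1.const_mul _).fun_add (i2.const_mul _)) fun x => ?_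
    refine (real_inner_le_norm _ _).trans ?_
    simp only [real_inner_self_eq_norm_sq]
    generalize ‖f t x‖ = p
    generalize ‖affineInTime a b t x‖ = q
    have : α * p ^ 2 + 1 / (4 * α) * q ^ 2 - p * q = α * (p - q / (2 * α)) ^ 2 := by
      field_simp; ring
    have : 0 ≤ α * (p - q / (2 * α)) ^ 2 := by positivity
    linarith
  refine key.trans (add_le_add le_rfl ?_)
  rw [one_div, div_eq_inv_mul]
  exact mul_le_mul_of_nonneg_left (hB t htI) (by positivity)

end Load

/-! ### Locality in time -/

section Locality

variable {u u' v v' w w' : ℝ → Pt → Pt} {t : ℝ}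

theorem dt_congr (h : u =ᶠ[𝓝 t] u') : dt u t = dt u' t := by
  ext1 x
  exact EventuallyEq.deriv_eq (h.mono fun s hs => congrFun hs x)

theorem vort_congr (hw : w t = w' t) (h : u =ᶠ[𝓝 t] u') : vort w u t = vort w' u' t := by
  ext1 x
  simp only [vort, dt_congr h, h.eq_of_nhds, hw]

/-- The form contains a time derivative, so it sees the fields near t and not only at t. Inside an
open time interval this permits replacing them by their affine formulas; their values at the nodes,
which `P1` leaves arbitrary, play no role. -/
theorem Kstab_congr {M : Mesh Ω} {ν : ℝ} {δ : Finset Pt → ℝ} (hu : u =ᶠ[𝓝 t] u')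
    (hv : v =ᶠ[𝓝 t] v') : Kstab M ν δ u u u v t = Kstab M ν δ u' u' u' v' t := by
  have h := hu.eq_of_nhds
  simp only [Kstab, stabC, stabL, stabJ, vort_congr h hu, vort_congr h hv, h, hv.eq_of_nhds]

theorem stabF_congr {M : Mesh Ω} {δ : Finset Pt → ℝ} {g : ℝ → Pt → ℝ} (hu : u =ᶠ[𝓝 t] u')
    (hv : v =ᶠ[𝓝 t] v') : stabF M δ g u v t = stabF M δ g u' v' t := by
  simp only [stabF, vort_congr hu.eq_of_nhds hv]

theorem vort_zero : vort w 0 t = 0 := by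
  ext1 x
  have h : (fun y => dt 0 t y + conv ((0 : ℝ → Pt → Pt) t) (w t) y) = 0 := by
    ext1 y
    simp [dt, conv]
  simp only [vort, h]
  simp [curl, pd]

theorem conv_zero_left (z : Pt → Pt) : conv 0 z = 0 := by
  ext1 x
  simp [conv]

theorem Mesh.jump_zero (M : Mesh Ω) (e : Finset Pt) (x : Pt) : M.jump e 0 x = 0 := by
  simp only [Mesh.jump, Pi.zero_apply, sub_zero]
  split_ifs
  · rfl
  · exact tendsto_const_nhds.limUnder_eq

theorem eps_zero (i j : Fin 2) (x : Pt) : eps 0 i j x = 0 := by simp [eps, pd]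

theorem Kstab_zero {M : Mesh Ω} {ν : ℝ} {δ : Finset Pt → ℝ} : Kstab M ν δ u u u 0 t = 0 := by
  simp [Kstab, formA, formC, stabC, stabL, stabJ, vort_zero, conv_zero_left, Mesh.jump_zero,
    eps_zero]

theorem stabF_zero {M : Mesh Ω} {δ : Finset Pt → ℝ} {g : ℝ → Pt → ℝ} :
    stabF M δ g u 0 t = 0 := by
  simp [stabF, vort_zero]

end Locality

/-! ### Summation over time intervals and the discrete energy inequality. -/

/-- The integral over time of a function which is given on each interval up to `n`, and vanishes
afterwards. -/
theorem integral_eq_sum_time {τ : ℝ} (hτ : 0 < τ) {n N : ℕ} (hn : n ≤ N) {h : ℝ → ℝ}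
    {H : ℕ → ℝ → ℝ}
    (h1 : ∀ m ≤ n, ∀ t ∈ Set.Ioo ((m : ℝ) * τ) ((m + 1) * τ), h t = H m t)
    (h2 : ∀ m ≤ n, IntegrableOn (H m) (Set.Ioo ((m : ℝ) * τ) ((m + 1) * τ)))
    (h3 : ∀ m, n < m → m ≤ N → ∀ t ∈ Set.Ioo ((m : ℝ) * τ) ((m + 1) * τ), h t = 0) :
    ∫ t in Set.Ioo 0 (((N : ℝ) + 1) * τ), h t =
      ∑ m ∈ Finset.range (n + 1), ∫ t in Set.Ioo ((m : ℝ) * τ) ((m + 1) * τ), H m t := by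
  have hle : ∀ m : ℕ, (m : ℝ) * τ ≤ ((m : ℝ) + 1) * τ := fun m => by nlinarith
  have hint : ∀ m < N + 1, IntervalIntegrable h volume ((m : ℝ) * τ) (((m + 1 : ℕ) : ℝ) * τ) := by
    intro m hm
    push_cast
    rw [intervalIntegrable_iff_integrableOn_Ioo_of_le (hle m)]
    rcases le_or_gt m n with hmn | hmn
    · exact (integrableOn_congr_fun (h1 m hmn) measurableSet_Ioo).2 (h2 m hmn)
    · exact (integrableOn_congr_fun (h3 m hmn (by omega)) measurableSet_Ioo).2 integrableOn_zero
  have hsum := intervalIntegral.sum_integral_adjacent_intervals hint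
  rw [← integral_Ioc_eq_integral_Ioo, ← intervalIntegral.integral_of_le (by positivity)]
  push_cast at hsum
  rw [zero_mul] at hsum
  rw [← hsum]
  refine (Finset.sum_subset_zero_on_sdiff (Finset.range_mono (by omega : n + 1 ≤ N + 1))
    (fun m hm => ?_) (fun m hm => ?_)).symm
  · simp only [Finset.mem_sdiff, Finset.mem_range] at hm
    rw [intervalIntegral.integral_of_le (hle m), integral_Ioc_eq_integral_Ioo,
      setIntegral_congr_fun measurableSet_Ioo (h3 m (by omega) (by omega)), integral_zero]
  · rw [intervalIntegral.integral_of_le (hle m), integral_Ioc_eq_integral_Ioo]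
    exact (setIntegral_congr_fun measurableSet_Ioo
      (h1 m (Nat.lt_succ_iff.1 (Finset.mem_range.1 hm)))).symm

/-- Convergence is pointwise in x: this is the topology on `Pt → Pt` in which `limPlus` and
`limMinus` take their limits. -/
theorem tendsto_affineInTime (a b : Pt → Pt) (t : ℝ) :
    Tendsto (affineInTime a b) (𝓝 t) (𝓝 (affineInTime a b t)) := by
  have : Continuous (affineInTime a b) := by
    unfold affineInTime
    fun_prop
  exact this.tendsto t

/-- Here x and y stand for the energies at the left and right ends of the intervals and J for the
jump energies. All interior values of x and y cancel, which leaves only the last y and the first x.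
-/
theorem sum_energy (x y J : ℕ → ℝ) (n : ℕ) :
    ∑ m ∈ Finset.range (n + 1), 1 / 2 * (y m - x m) +
        ∑ j ∈ Finset.range n, (1 / 2 * x (j + 1) - 1 / 2 * y j + 1 / 2 * J j) + x 0 =
      1 / 2 * y n + 1 / 2 * ∑ j ∈ Finset.range n, J j + 1 / 2 * x 0 := by
  induction n with
  | zero => simp; ring
  | succ n ih =>
    rw [Finset.sum_range_succ _ (n + 1), Finset.sum_range_succ J n,
      Finset.sum_range_succ (fun j => 1 / 2 * x (j + 1) - 1 / 2 * y j + 1 / 2 * J j) n]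
    linarith

/-- The maximum over time of an energy that is controlled by the data and a fraction of the
maximum. -/
theorem le_of_energy {x y J : ℕ → ℝ} {R : ℝ} {n : ℕ} (hy : ∀ m, 0 ≤ y m)
    (hx0 : ∀ m, 0 ≤ x m) (hJ : ∀ m, 0 ≤ J m) (hx : ∀ j, j < n → x (j + 1) ≤ 2 * y j + 2 * J j)
    (h : ∀ n' ≤ n, ∀ B, (∀ m ≤ n', x m ≤ B ∧ y m ≤ B) →
      1 / 2 * y n' + 1 / 2 * ∑ j ∈ Finset.range n', J j + 1 / 4 * x 0 ≤ R + B / 32) :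
    ∀ m ≤ n, x m ≤ 11 * R ∧ y m ≤ 11 * R := by
  obtain ⟨m₀, hm₀, hmax⟩ := Finset.exists_max_image (Finset.range (n + 1))
    (fun m => max (x m) (y m)) ⟨0, by simp⟩
  set B := max (x m₀) (y m₀) with hB
  have hle : ∀ m ≤ n, x m ≤ B ∧ y m ≤ B := fun m hm =>
    max_le_iff.1 (hmax m (Finset.mem_range.2 (by omega)))
  have hE := fun n' (hn' : n' ≤ n) => h n' hn' B fun m hm => hle m (hm.trans hn')
  have hS : ∀ n', 0 ≤ ∑ j ∈ Finset.range n', J j := fun n' =>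
    Finset.sum_nonneg fun j _ => hJ j
  have hyb : ∀ m ≤ n, y m ≤ 2 * (R + B / 32) := fun m hm => by
    linarith [hE m hm, hS m, hx0 0]
  -- Both `y j` and `J j` are at most 2(R + B/32), and `hx` doubles each, whence the factor 8. The
  -- first left end has no predecessor and is controlled by its own term in the energy.
  have hxb : ∀ m ≤ n, x m ≤ 8 * (R + B / 32) := by
    intro m hm
    rcases m with _ | j
    · linarith [hE 0 hm, hS 0, hy 0, hx0 0]
    · have h1 := hE (j + 1) hm
      rw [Finset.sum_range_succ] at h1
      linarith [hx j hm, hyb j (by omega), hS j, hx0 0, hy (j + 1)]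
  have hBb : B ≤ 8 * (R + B / 32) := by
    have hm : m₀ ≤ n := Nat.lt_succ_iff.1 (Finset.mem_range.1 hm₀)
    refine max_le (hxb m₀ hm) ((hyb m₀ hm).trans ?_)
    linarith [(hy m₀).trans (hyb m₀ hm)]
  -- From B ≤ 8R + B/4 one gets B ≤ (32/3) R, and nonnegativity of B makes R nonnegative, so 32/3
  -- may be rounded up to 11.
  have hB0 : 0 ≤ B := (hx0 m₀).trans (le_max_left _ _)
  intro m hm
  have := hle m hm
  constructor <;> linarith

/-! ### The energy estimate for the discrete solution. -/

section Energy

variable {M : Mesh Ω} {k : ℕ} {S : FESpaces M k} {ν τ : ℝ} {δ : Finset Pt → ℝ} {N : ℕ}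
  {f : ℝ → Pt → Pt} {g : ℝ → Pt → ℝ} {U₀ : Pt → Pt} {U : ℝ → Pt → Pt} {a b : ℕ → Pt → Pt}

theorem eventually_eq_affineInTime
    (hU : ∀ m ≤ N, ∀ t ∈ Set.Ioo ((m : ℝ) * τ) ((m + 1) * τ), U t = affineInTime (a m) (b m) t)
    {m : ℕ} (hm : m ≤ N) {t : ℝ} (ht : t ∈ Set.Ioo ((m : ℝ) * τ) ((m + 1) * τ)) :
    U =ᶠ[𝓝 t] affineInTime (a m) (b m) :=
  Filter.eventuallyEq_of_mem (Ioo_mem_nhds ht.1 ht.2) (hU m hm)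

theorem limPlus_eq (hτ : 0 < τ) {v w : ℝ → Pt → Pt} {m : ℕ} {y : Pt → Pt}
    (h : ∀ t ∈ Set.Ioo ((m : ℝ) * τ) ((m + 1) * τ), v t = w t)
    (hw : Tendsto w (𝓝 (m * τ)) (𝓝 y)) : limPlus τ v m = y := by
  refine rightLim_eq_of_tendsto ((hw.mono_left nhdsWithin_le_nhds).congr' ?_)
  filter_upwards [Ioo_mem_nhdsGT (show (m : ℝ) * τ < (m + 1) * τ by nlinarith)] with t ht
  exact (h t ht).symm

theorem limMinus_eq (hτ : 0 < τ) {v w : ℝ → Pt → Pt} {m : ℕ} {y : Pt → Pt}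
    (h : ∀ t ∈ Set.Ioo ((m : ℝ) * τ) ((m + 1) * τ), v t = w t)
    (hw : Tendsto w (𝓝 ((m + 1) * τ)) (𝓝 y)) : limMinus τ v (m + 1) = y := by
  rw [limMinus]
  push_cast
  refine leftLim_eq_of_tendsto ((hw.mono_left nhdsWithin_le_nhds).congr' ?_)
  filter_upwards [Ioo_mem_nhdsLT (show (m : ℝ) * τ < (m + 1) * τ by nlinarith)] with t ht
  exact (h t ht).symm

/-- The discrete equation tested with the solution up to time `(n + 1) τ`. -/
theorem energy_identity (hΩ : IsPolygonalDomain Ω) (hτ : 0 < τ)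
    (hsol : IsDiscreteSolution S ν δ τ N f g U₀ U)
    (ha : ∀ m ≤ N, a m ∈ S.Zh) (hb : ∀ m ≤ N, b m ∈ S.Zh)
    (hU : ∀ m ≤ N, ∀ t ∈ Set.Ioo ((m : ℝ) * τ) ((m + 1) * τ), U t = affineInTime (a m) (b m) t)
    (hf : ∀ m ≤ N, MemLp (fun z : ℝ × Pt => f z.1 z.2) 2
      ((volume.restrict (Set.Ioo ((m : ℝ) * τ) ((m + 1) * τ))).prod (volume.restrict Ω)))
    (hg : ∀ m ≤ N, ∀ E ∈ M.cells, MemLp (fun z : ℝ × Pt => g z.1 z.2) 2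
      ((volume.restrict (Set.Ioo ((m : ℝ) * τ) ((m + 1) * τ))).prod (volume.restrict (cell E))))
    {n : ℕ} (hn : n ≤ N) :
    ∑ m ∈ Finset.range (n + 1), (∫ t in Set.Ioo ((m : ℝ) * τ) ((m + 1) * τ),
        ip Ω (b m) (affineInTime (a m) (b m) t)) +
      ∑ j ∈ Finset.range n, ip Ω (affineInTime (a (j + 1)) (b (j + 1)) (((j + 1 : ℕ) : ℝ) * τ) -
        affineInTime (a j) (b j) ((j + 1) * τ))
        (affineInTime (a (j + 1)) (b (j + 1)) (((j + 1 : ℕ) : ℝ) * τ)) +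
      ip Ω (affineInTime (a 0) (b 0) (((0 : ℕ) : ℝ) * τ))
        (affineInTime (a 0) (b 0) (((0 : ℕ) : ℝ) * τ)) +
      ∑ m ∈ Finset.range (n + 1), (∫ t in Set.Ioo ((m : ℝ) * τ) ((m + 1) * τ),
        Kstab M ν δ (affineInTime (a m) (b m)) (affineInTime (a m) (b m))
          (affineInTime (a m) (b m)) (affineInTime (a m) (b m)) t) =
    ∑ m ∈ Finset.range (n + 1), (∫ t in Set.Ioo ((m : ℝ) * τ) ((m + 1) * τ),
        ip Ω (f t) (affineInTime (a m) (b m) t)) +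
      ∑ m ∈ Finset.range (n + 1), (∫ t in Set.Ioo ((m : ℝ) * τ) ((m + 1) * τ),
        stabF M δ g (affineInTime (a m) (b m)) (affineInTime (a m) (b m)) t) +
      ip Ω U₀ (affineInTime (a 0) (b 0) (((0 : ℕ) : ℝ) * τ)) := by
  classical
  -- Cutting off at a node keeps the field affine on every interval, and no continuity between
  -- intervals is demanded.
  set V : ℝ → Pt → Pt := fun t => if t < (n + 1) * τ then U t else 0 with hV
  have hVle : ∀ m ≤ n, ∀ t ∈ Set.Ioo ((m : ℝ) * τ) ((m + 1) * τ),
      V t = affineInTime (a m) (b m) t := by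
    intro m hm t ht
    have hmn : (m : ℝ) ≤ n := by exact_mod_cast hm
    have : t < (n + 1) * τ := ht.2.trans_le (by gcongr)
    rw [hV]
    simp only [this, if_true]
    exact hU m (hm.trans hn) t ht
  have hVgt : ∀ m, n < m → ∀ t ∈ Set.Ioo ((m : ℝ) * τ) ((m + 1) * τ), V t = 0 := by
    intro m hm t ht
    have hmn : (n : ℝ) + 1 ≤ m := by exact_mod_cast hm
    have : ¬ t < (n + 1) * τ := not_lt.2 (le_trans (by gcongr) ht.1.le)
    rw [hV]
    simp only [this, if_false]
  have hVmem : V ∈ P1 τ N S.Zh := by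
    intro m hm
    rcases le_or_gt m n with h | h
    · exact ⟨a m, ha m hm, b m, hb m hm, hVle m h⟩
    · refine ⟨0, FESpaces.zero_mem_Zh, 0, FESpaces.zero_mem_Zh, fun t ht => ?_⟩
      rw [hVgt m h t ht]
      simp
  have hVev : ∀ m ≤ n, ∀ t ∈ Set.Ioo ((m : ℝ) * τ) ((m + 1) * τ),
      V =ᶠ[𝓝 t] affineInTime (a m) (b m) := fun m hm t ht =>
    Filter.eventuallyEq_of_mem (Ioo_mem_nhds ht.1 ht.2) (hVle m hm)
  have hVev0 : ∀ m, n < m → ∀ t ∈ Set.Ioo ((m : ℝ) * τ) ((m + 1) * τ),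
      V =ᶠ[𝓝 t] 0 := fun m hm t ht =>
    Filter.eventuallyEq_of_mem (Ioo_mem_nhds ht.1 ht.2) (hVgt m hm)
  have hUev := fun m hm t ht => eventually_eq_affineInTime hU (m := m) hm (t := t) ht
  have hIoo : ∀ {h : ℝ → ℝ} (s r : ℝ), Continuous h → IntegrableOn h (Set.Ioo s r) :=
    fun s r hh => (hh.continuousOn.integrableOn_Icc).mono_set Set.Ioo_subset_Icc_self
  have heq := hsol.2 V hVmem
  have t1 : ∫ t in Set.Ioo 0 (((N : ℝ) + 1) * τ), ip Ω (dt U t) (V t) =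
      ∑ m ∈ Finset.range (n + 1), (∫ t in Set.Ioo ((m : ℝ) * τ) ((m + 1) * τ),
        ip Ω (b m) (affineInTime (a m) (b m) t)) := by
    refine integral_eq_sum_time hτ hn (H := fun m t => ip Ω (b m) (affineInTime (a m) (b m) t))
      (fun m hm t ht => ?_) (fun m hm => ?_) (fun m hm hmN t ht => ?_)
    · rw [dt_congr (hUev m (hm.trans hn) t ht), dt_affineInTime, hVle m hm t ht]
    · exact hIoo _ _ (FESpaces.continuous_ip_slope hΩ (ha m (hm.trans hn)).1 (hb m (hm.trans hn)).1)
    · rw [hVgt m hm t ht, ip_zero_right]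
  have t2 : ∫ t in Set.Ioo 0 (((N : ℝ) + 1) * τ), Kstab M ν δ U U U V t =
      ∑ m ∈ Finset.range (n + 1), (∫ t in Set.Ioo ((m : ℝ) * τ) ((m + 1) * τ),
        Kstab M ν δ (affineInTime (a m) (b m)) (affineInTime (a m) (b m))
          (affineInTime (a m) (b m)) (affineInTime (a m) (b m)) t) := by
    refine integral_eq_sum_time hτ hn (H := fun m => Kstab M ν δ (affineInTime (a m) (b m))
      (affineInTime (a m) (b m)) (affineInTime (a m) (b m)) (affineInTime (a m) (b m)))
      (fun m hm t ht => ?_) (fun m hm => ?_) (fun m hm hmN t ht => ?_)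
    · exact Kstab_congr (hUev m (hm.trans hn) t ht) (hVev m hm t ht)
    · exact hIoo _ _ (FESpaces.continuous_Kstab hΩ (ha m (hm.trans hn)) (hb m (hm.trans hn)) ν δ)
    · rw [Kstab_congr (EventuallyEq.refl _ U) (hVev0 m hm t ht), Kstab_zero]
  have t3 : ∫ t in Set.Ioo 0 (((N : ℝ) + 1) * τ), ip Ω (f t) (V t) =
      ∑ m ∈ Finset.range (n + 1), (∫ t in Set.Ioo ((m : ℝ) * τ) ((m + 1) * τ),
        ip Ω (f t) (affineInTime (a m) (b m) t)) := by
    refine integral_eq_sum_time hτ hn (H := fun m t => ip Ω (f t) (affineInTime (a m) (b m) t))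
      (fun m hm t ht => ?_) (fun m hm => ?_) (fun m hm hmN t ht => ?_)
    · rw [hVle m hm t ht]
    · exact FESpaces.integrableOn_ip_load hΩ (ha m (hm.trans hn)).1 (hb m (hm.trans hn)).1
        (hf m (hm.trans hn))
    · rw [hVgt m hm t ht, ip_zero_right]
  have t4 : ∫ t in Set.Ioo 0 (((N : ℝ) + 1) * τ), stabF M δ g U V t =
      ∑ m ∈ Finset.range (n + 1), (∫ t in Set.Ioo ((m : ℝ) * τ) ((m + 1) * τ),
        stabF M δ g (affineInTime (a m) (b m)) (affineInTime (a m) (b m)) t) := by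
    refine integral_eq_sum_time hτ hn (H := fun m => stabF M δ g (affineInTime (a m) (b m))
      (affineInTime (a m) (b m)))
      (fun m hm t ht => ?_) (fun m hm => ?_) (fun m hm hmN t ht => ?_)
    · exact stabF_congr (hUev m (hm.trans hn) t ht) (hVev m hm t ht)
    · exact FESpaces.integrableOn_stabF (ha m (hm.trans hn)).1 (hb m (hm.trans hn)).1 δ
        (hg m (hm.trans hn))
    · rw [stabF_congr (EventuallyEq.refl _ U) (hVev0 m hm t ht), stabF_zero]
  have lU : ∀ m ≤ N, limPlus τ U m = affineInTime (a m) (b m) (m * τ) := fun m hm =>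
    limPlus_eq hτ (hU m hm) (tendsto_affineInTime _ _ _)
  have lU' : ∀ m ≤ N, limMinus τ U (m + 1) = affineInTime (a m) (b m) ((m + 1) * τ) :=
    fun m hm => limMinus_eq hτ (hU m hm) (tendsto_affineInTime _ _ _)
  have lV : ∀ m ≤ n, limPlus τ V m = affineInTime (a m) (b m) (m * τ) := fun m hm =>
    limPlus_eq hτ (hVle m hm) (tendsto_affineInTime _ _ _)
  have lV0 : ∀ m, n < m → limPlus τ V m = 0 := fun m hm =>
    limPlus_eq hτ (w := fun _ => 0) (hVgt m hm) tendsto_const_nhds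
  -- The jump of U is paired with the limit of V from the right, which is zero from t_{n+1} on. So
  -- the artificial jump of V at the cut contributes nothing, and n jumps remain.
  have t5 : ∑ j ∈ Finset.Icc 1 N, ip Ω (limPlus τ U j - limMinus τ U j) (limPlus τ V j) =
      ∑ j ∈ Finset.range n, ip Ω (affineInTime (a (j + 1)) (b (j + 1)) (((j + 1 : ℕ) : ℝ) * τ) -
        affineInTime (a j) (b j) ((j + 1) * τ))
        (affineInTime (a (j + 1)) (b (j + 1)) (((j + 1 : ℕ) : ℝ) * τ)) := by
    have hIcc : Finset.Icc 1 N = Finset.Ico 1 (N + 1) := by ext; simp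
    rw [hIcc, Finset.sum_Ico_eq_sum_range, Nat.add_sub_cancel]
    refine (Finset.sum_subset_zero_on_sdiff (Finset.range_mono hn) (fun j hj => ?_)
      (fun j hj => ?_)).symm
    · simp only [Finset.mem_sdiff, Finset.mem_range] at hj
      rw [lV0 (1 + j) (by omega), ip_zero_right]
    · have hj := Finset.mem_range.1 hj
      rw [add_comm 1 j, lU (j + 1) (by omega), lU' j (by omega), lV (j + 1) (by omega)]
  rw [Astab, Rstab, t1, t2, t3, t4, t5, lU 0 (Nat.zero_le _), lV 0 (Nat.zero_le _)] at heq
  exact heq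

theorem integrableOn_integral_sq {s r : ℝ} {E : Finset Pt}
    (hg : MemLp (fun z : ℝ × Pt => g z.1 z.2) 2
      ((volume.restrict (Set.Ioo s r)).prod (volume.restrict (cell E)))) :
    IntegrableOn (fun t => ∫ x in cell E, g t x ^ 2) (Set.Ioo s r) :=
  Integrable.integral_prod_left hg.integrable_sq

/-- Coercivity, integrated over a time interval. -/
theorem integral_Kstab_coercivity (hΩ : IsPolygonalDomain Ω) (hν : 0 < ν)
    (hδ : ∀ E ∈ M.cells, 0 ≤ δ E ∧ δ E ≤ diamE E ^ 4 / (ν * invConst (k + 2) E ^ 2))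
    {a b : Pt → Pt} (ha : a ∈ S.Zh) (hb : b ∈ S.Zh) {s r : ℝ}
    (hg : ∀ E ∈ M.cells, MemLp (fun z : ℝ × Pt => g z.1 z.2) 2
      ((volume.restrict (Set.Ioo s r)).prod (volume.restrict (cell E)))) :
    (∫ t in Set.Ioo s r, stabF M δ g (affineInTime a b) (affineInTime a b) t) -
        ∑ E ∈ M.cells, δ E * ∫ t in Set.Ioo s r, ∫ x in cell E, g t x ^ 2 ≤
      ∫ t in Set.Ioo s r, Kstab M ν δ (affineInTime a b) (affineInTime a b) (affineInTime a b)
        (affineInTime a b) t := by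
  have h1 := FESpaces.integrableOn_stabF ha.1 hb.1 δ hg
  have h2 : ∀ E ∈ M.cells, IntegrableOn (fun t => δ E * ∫ x in cell E, g t x ^ 2) (Set.Ioo s r) :=
    fun E hE => (integrableOn_integral_sq (hg E hE)).const_mul _
  have h3 : IntegrableOn (Kstab M ν δ (affineInTime a b) (affineInTime a b) (affineInTime a b)
      (affineInTime a b)) (Set.Ioo s r) :=
    ((FESpaces.continuous_Kstab hΩ ha hb ν δ).continuousOn.integrableOn_Icc).mono_set
      Set.Ioo_subset_Icc_self
  have e : ∑ E ∈ M.cells, δ E * ∫ t in Set.Ioo s r, ∫ x in cell E, g t x ^ 2 =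
      ∑ E ∈ M.cells, ∫ t in Set.Ioo s r, δ E * ∫ x in cell E, g t x ^ 2 :=
    Finset.sum_congr rfl fun E _ => (integral_const_mul _ _).symm
  rw [e, ← integral_finsetSum _ h2, ← integral_sub h1 (integrable_finsetSum _ h2)]
  refine integral_mono_ae (h1.sub' (integrable_finsetSum _ h2)) h3 ?_
  have hae : ∀ᵐ t ∂(volume.restrict (Set.Ioo s r)),
      ∀ E ∈ M.cells, MemLp (g t) 2 (volume.restrict (cell E)) := by
    rw [Filter.eventually_all_finset]
    exact fun E hE => ae_memLp_prodMk (hg E hE)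
  filter_upwards [hae] with t ht
  have := FESpaces.Kstab_coercivity hΩ ha hb hν hδ ht
  linarith

/-- The energy of the discrete solution at the ends of the time intervals. -/
theorem nodal_bound (hΩ : IsPolygonalDomain Ω) (hτ : 0 < τ) {T : ℝ} (hT : (N + 1) * τ = T)
    (hν : 0 < ν)
    (hδ : ∀ E ∈ M.cells, 0 ≤ δ E ∧ δ E ≤ diamE E ^ 4 / (ν * invConst (k + 2) E ^ 2))
    (hU₀ : U₀ ∈ S.Vh) (hsol : IsDiscreteSolution S ν δ τ N f g U₀ U)
    (ha : ∀ m ≤ N, a m ∈ S.Zh) (hb : ∀ m ≤ N, b m ∈ S.Zh)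
    (hU : ∀ m ≤ N, ∀ t ∈ Set.Ioo ((m : ℝ) * τ) ((m + 1) * τ), U t = affineInTime (a m) (b m) t)
    (hf : ∀ m ≤ N, MemLp (fun z : ℝ × Pt => f z.1 z.2) 2
      ((volume.restrict (Set.Ioo ((m : ℝ) * τ) ((m + 1) * τ))).prod (volume.restrict Ω)))
    (hg : ∀ m ≤ N, ∀ E ∈ M.cells, MemLp (fun z : ℝ × Pt => g z.1 z.2) 2
      ((volume.restrict (Set.Ioo ((m : ℝ) * τ) ((m + 1) * τ))).prod (volume.restrict (cell E))))
    {n : ℕ} (hn : n ≤ N) :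
    ip Ω (affineInTime (a n) (b n) (n * τ)) (affineInTime (a n) (b n) (n * τ)) ≤
        11 * ((8 * T + 1) * DATA M δ τ f g U₀ n) ∧
      ip Ω (affineInTime (a n) (b n) ((n + 1) * τ)) (affineInTime (a n) (b n) ((n + 1) * τ)) ≤
        11 * ((8 * T + 1) * DATA M δ τ f g U₀ n) := by
  have hT0 : 0 < T := by rw [← hT]; positivity
  set P : ℕ → Pt → Pt := fun m => affineInTime (a m) (b m) (m * τ) with hP
  set Q : ℕ → Pt → Pt := fun m => affineInTime (a m) (b m) ((m + 1) * τ) with hQ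
  have hPV : ∀ m ≤ N, P m ∈ S.Vh := fun m hm =>
    FESpaces.affineInTime_mem (ha m hm).1 (hb m hm).1 _
  have hQV : ∀ m ≤ N, Q m ∈ S.Vh := fun m hm =>
    FESpaces.affineInTime_mem (ha m hm).1 (hb m hm).1 _
  set Fm : ℕ → ℝ := fun m => ∫ t in Set.Ioo ((m : ℝ) * τ) ((m + 1) * τ), ∫ x in Ω, ‖f t x‖ ^ 2
    with hFm
  set Gm : ℕ → ℝ := fun m => ∑ E ∈ M.cells, δ E *
    ∫ t in Set.Ioo ((m : ℝ) * τ) ((m + 1) * τ), ∫ x in cell E, g t x ^ 2 with hGm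
  have hF0 : ∀ m, 0 ≤ Fm m := fun m =>
    integral_nonneg fun t => integral_nonneg fun x => sq_nonneg _
  have hG0 : ∀ m, 0 ≤ Gm m := fun m => Finset.sum_nonneg fun E hE =>
    mul_nonneg (hδ E hE).1 (integral_nonneg fun t => integral_nonneg fun x => sq_nonneg _)
  have hDATA : DATA M δ τ f g U₀ n = ip Ω U₀ U₀ + ∑ m ∈ Finset.range (n + 1), Fm m +
      ∑ m ∈ Finset.range (n + 1), Gm m := by
    rw [DATA, ip_self_eq]
    congr 1
    · congr 1
      exact integral_eq_sum_time hτ le_rfl (H := fun _ t => ∫ x in Ω, ‖f t x‖ ^ 2)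
        (fun _ _ _ _ => rfl) (fun m hm => integrableOn_integral_normSq (hf m (hm.trans hn)))
        (fun m h h' => absurd h' (not_le.2 h))
    · rw [hGm, Finset.sum_comm]
      refine Finset.sum_congr rfl fun E hE => ?_
      rw [← Finset.mul_sum]
      congr 1
      exact integral_eq_sum_time hτ le_rfl (H := fun _ t => ∫ x in cell E, g t x ^ 2)
        (fun _ _ _ _ => rfl) (fun m hm => integrableOn_integral_sq (hg m (hm.trans hn) E hE))
        (fun m h h' => absurd h' (not_le.2 h))
  -- The data of all n + 1 intervals enter R, so that one R serves every intermediate time n' ≤ n.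
  set R : ℝ := 8 * T * (∑ m ∈ Finset.range (n + 1), Fm m) +
    (∑ m ∈ Finset.range (n + 1), Gm m) + ip Ω U₀ U₀ with hR
  have hRD : R ≤ (8 * T + 1) * DATA M δ τ f g U₀ n := by
    have h1 : 0 ≤ ∑ m ∈ Finset.range (n + 1), Fm m := Finset.sum_nonneg fun m _ => hF0 m
    have h2 : 0 ≤ T * ∑ m ∈ Finset.range (n + 1), Gm m :=
      mul_nonneg hT0.le (Finset.sum_nonneg fun m _ => hG0 m)
    have h3 : 0 ≤ T * ip Ω U₀ U₀ := mul_nonneg hT0.le (ip_self_nonneg _)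
    rw [hDATA, hR]
    linarith
  suffices h : ∀ m ≤ n, ip Ω (P m) (P m) ≤ 11 * R ∧ ip Ω (Q m) (Q m) ≤ 11 * R from
    ⟨(h n le_rfl).1.trans (by linarith), (h n le_rfl).2.trans (by linarith)⟩
  refine le_of_energy (J := fun j => ip Ω (P (j + 1) - Q j) (P (j + 1) - Q j))
    (fun _ => ip_self_nonneg _) (fun _ => ip_self_nonneg _) (fun _ => ip_self_nonneg _)
    (fun j hj => FESpaces.ip_self_le hΩ (hPV _ (by omega)) (hQV _ (by omega))) ?_
  intro n' hn' B hB
  have hE := energy_identity hΩ hτ hsol ha hb hU hf hg (hn'.trans hn)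
  have hmN : ∀ m ∈ Finset.range (n' + 1), m ≤ N := fun m hm => by
    have := Finset.mem_range.1 hm
    omega
  have e1 : ∑ m ∈ Finset.range (n' + 1), (∫ t in Set.Ioo ((m : ℝ) * τ) ((m + 1) * τ),
      ip Ω (b m) (affineInTime (a m) (b m) t)) =
      ∑ m ∈ Finset.range (n' + 1), 1 / 2 * (ip Ω (Q m) (Q m) - ip Ω (P m) (P m)) :=
    Finset.sum_congr rfl fun m hm => FESpaces.integral_ip_slope hΩ (ha m (hmN m hm)).1
      (hb m (hmN m hm)).1 (by nlinarith)
  have e2 : ∑ j ∈ Finset.range n', ip Ω (P (j + 1) - Q j) (P (j + 1)) =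
      ∑ j ∈ Finset.range n', (1 / 2 * ip Ω (P (j + 1)) (P (j + 1)) - 1 / 2 * ip Ω (Q j) (Q j) +
        1 / 2 * ip Ω (P (j + 1) - Q j) (P (j + 1) - Q j)) :=
    Finset.sum_congr rfl fun j hj => by
      have := Finset.mem_range.1 hj
      exact FESpaces.ip_sub_left hΩ (hPV _ (by omega)) (hQV _ (by omega))
  have e3 := sum_energy (fun m => ip Ω (P m) (P m)) (fun m => ip Ω (Q m) (Q m))
    (fun j => ip Ω (P (j + 1) - Q j) (P (j + 1) - Q j)) n'
  have e4 : ∑ m ∈ Finset.range (n' + 1), (∫ t in Set.Ioo ((m : ℝ) * τ) ((m + 1) * τ),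
        stabF M δ g (affineInTime (a m) (b m)) (affineInTime (a m) (b m)) t) -
      ∑ m ∈ Finset.range (n' + 1), Gm m ≤
      ∑ m ∈ Finset.range (n' + 1), (∫ t in Set.Ioo ((m : ℝ) * τ) ((m + 1) * τ),
        Kstab M ν δ (affineInTime (a m) (b m)) (affineInTime (a m) (b m))
          (affineInTime (a m) (b m)) (affineInTime (a m) (b m)) t) := by
    rw [← Finset.sum_sub_distrib]
    exact Finset.sum_le_sum fun m hm => integral_Kstab_coercivity hΩ hν hδ (ha m (hmN m hm))
      (hb m (hmN m hm)) (hg m (hmN m hm))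
  -- Young's inequality with α = 8T costs τB/(32T) per interval. The intervals used have total
  -- length at most (N + 1)τ = T, so together they cost at most B/32.
  have e5 : ∑ m ∈ Finset.range (n' + 1), (∫ t in Set.Ioo ((m : ℝ) * τ) ((m + 1) * τ),
        ip Ω (f t) (affineInTime (a m) (b m) t)) ≤
      8 * T * (∑ m ∈ Finset.range (n' + 1), Fm m) + B / 32 := by
    have h1 : ∀ m ∈ Finset.range (n' + 1), (∫ t in Set.Ioo ((m : ℝ) * τ) ((m + 1) * τ),
        ip Ω (f t) (affineInTime (a m) (b m) t)) ≤
        8 * T * Fm m + τ * (B / (4 * (8 * T))) := fun m hm => by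
      have hmB := hB m (Nat.lt_succ_iff.1 (Finset.mem_range.1 hm))
      have h := FESpaces.integral_ip_load_le hΩ (ha m (hmN m hm)).1 (hb m (hmN m hm)).1
        (hf m (hmN m hm)) (by nlinarith) (show 0 < 8 * T by positivity) (B := B)
        (fun t ht => FESpaces.ip_affineInTime_le hΩ (ha m (hmN m hm)).1 (hb m (hmN m hm)).1 ht
          hmB.1 hmB.2)
      rwa [show ((m : ℝ) + 1) * τ - m * τ = τ by ring] at h
    refine (Finset.sum_le_sum h1).trans ?_
    rw [Finset.sum_add_distrib, ← Finset.mul_sum, Finset.sum_const, Finset.card_range,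
      nsmul_eq_mul]
    have hB0 : 0 ≤ B := (ip_self_nonneg _).trans (hB 0 (Nat.zero_le _)).1
    have hle : ((n' + 1 : ℕ) : ℝ) * τ ≤ T := by
      rw [← hT]
      push_cast
      have : (n' : ℝ) ≤ N := by exact_mod_cast hn'.trans hn
      gcongr
    have : ((n' + 1 : ℕ) : ℝ) * (τ * (B / (4 * (8 * T)))) ≤ T * (B / (4 * (8 * T))) := by
      rw [← mul_assoc]
      gcongr
    have e : T * (B / (4 * (8 * T))) = B / 32 := by field_simp; ring
    linarith
  have e6 := FESpaces.ip_le hΩ hU₀ (hPV 0 (Nat.zero_le _))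
  have hsub : Finset.range (n' + 1) ⊆ Finset.range (n + 1) := Finset.range_mono (by omega)
  have e7 : ∑ m ∈ Finset.range (n' + 1), Fm m ≤ ∑ m ∈ Finset.range (n + 1), Fm m :=
    Finset.sum_le_sum_of_subset_of_nonneg hsub fun m _ _ => hF0 m
  have e8 : ∑ m ∈ Finset.range (n' + 1), Gm m ≤ ∑ m ∈ Finset.range (n + 1), Gm m :=
    Finset.sum_le_sum_of_subset_of_nonneg hsub fun m _ _ => hG0 m
  have e9 := mul_le_mul_of_nonneg_left e7 (show 0 ≤ 8 * T by positivity)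
  rw [e1] at hE
  change _ + ∑ j ∈ Finset.range n', ip Ω (P (j + 1) - Q j) (P (j + 1)) + ip Ω (P 0) (P 0) + _ =
    _ + _ + ip Ω U₀ (P 0) at hE
  rw [e2] at hE
  linarith

/-- By convexity of the energy in time, the two end values bound the essential supremum. -/
theorem normLinfL2_sq_le (hΩ : IsPolygonalDomain Ω) {a b : Pt → Pt} (ha : a ∈ S.Vh)
    (hb : b ∈ S.Vh) {s r X : ℝ} (hU : ∀ t ∈ Set.Ioo s r, U t = affineInTime a b t)
    (h1 : ip Ω (affineInTime a b s) (affineInTime a b s) ≤ X)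
    (h2 : ip Ω (affineInTime a b r) (affineInTime a b r) ≤ X) :
    normLinfL2 Ω s r U ^ 2 ≤ ENNReal.ofReal X := by
  have hX : 0 ≤ X := (ip_self_nonneg _).trans h1
  have h : normLinfL2 Ω s r U ≤ ENNReal.ofReal √X := by
    refine essSup_le_of_ae_le _ ?_
    filter_upwards [ae_restrict_mem measurableSet_Ioo] with t ht
    rw [hU t ht, (FESpaces.memLp hΩ (FESpaces.affineInTime_mem ha hb t)).eLpNorm_eq_integral_rpow_norm
      two_ne_zero ENNReal.ofNat_ne_top]
    refine ENNReal.ofReal_le_ofReal ?_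
    have := FESpaces.ip_affineInTime_le hΩ ha hb ht h1 h2
    rw [ip_self_eq] at this
    rw [Real.sqrt_eq_rpow]
    simp only [ENNReal.toReal_ofNat, Real.rpow_two, one_div]
    exact Real.rpow_le_rpow (integral_nonneg fun _ => sq_nonneg _) this (by norm_num)
  calc normLinfL2 Ω s r U ^ 2 ≤ ENNReal.ofReal √X ^ 2 := by gcongr
    _ = ENNReal.ofReal X := by
      rw [← ENNReal.ofReal_pow (Real.sqrt_nonneg _), Real.sq_sqrt hX]

end Energy

/-- A cell lies in the closure of Ω, but may contain boundary segments of Ω such as slits, so the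
inclusion in Ω holds only up to a null set. -/
theorem Mesh.restrict_cell_le (M : Mesh Ω) (hΩ : IsPolygonalDomain Ω) {E : Finset Pt}
    (hE : E ∈ M.cells) : volume.restrict (cell E) ≤ volume.restrict Ω := by
  refine Measure.restrict_mono_ae (LE.le.eventuallyLE ?_ |>.trans
    (M.iUnion_cell_ae_eq hΩ).le)
  exact Set.subset_biUnion_of_mem (u := fun E => cell E) hE

end VortStab

end

theorem mainTheorem4 (Ω : Set Pt) (hΩ : IsPolygonalDomain Ω) (T : ℝ) (hT : 0 < T)
    (k : ℕ) (cM1 : ℝ) :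
    ∃ C : ℝ, 0 < C ∧
      ∀ (M : Mesh Ω), M.ShapeRegular cM1 →
      ∀ (S : FESpaces M k) (N : ℕ) (τ : ℝ), (N + 1) * τ = T →
      ∀ (ν : ℝ), 0 < ν →
      ∀ (δ : Finset Pt → ℝ),
        (∀ E ∈ M.cells, 0 ≤ δ E ∧ δ E ≤ diamE E ^ 4 / (ν * invConst (k + 2) E ^ 2)) →
      ∀ (f : ℝ → Pt → Pt) (g : ℝ → Pt → ℝ),
        MemLp (fun z : ℝ × Pt => f z.1 z.2) 2
          ((volume.restrict (Set.Ioo 0 T)).prod (volume.restrict Ω)) →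
        MemLp (fun z : ℝ × Pt => g z.1 z.2) 2
          ((volume.restrict (Set.Ioo 0 T)).prod (volume.restrict Ω)) →
        (∀ᵐ t ∂(volume.restrict (Set.Ioo 0 T)), HasWeakCurl Ω (f t) (g t)) →
      ∀ U₀ ∈ S.Vh, ∀ U : ℝ → Pt → Pt,
        IsDiscreteSolution S ν δ τ N f g U₀ U →
        ∀ n ≤ N, normLinfL2 Ω (n * τ) ((n + 1) * τ) U ^ 2 ≤
          ENNReal.ofReal (C * DATA M δ τ f g U₀ n) := by
  -- The factor 11 comes from absorbing the maximal energy, and 8T + 1 dominates the weights 8T of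
  -- the load and 1 of the other data.
  refine ⟨11 * (8 * T + 1), by positivity, ?_⟩
  intro M _ S N τ hNτ ν hν δ hδ f g hf hg _ U₀ hU₀ U hsol n hn
  have hτ : 0 < τ := by
    have h1 : (0 : ℝ) < N + 1 := by positivity
    exact pos_of_mul_pos_right (hNτ ▸ hT) h1.le
  have hI : ∀ m ≤ N, volume.restrict (Set.Ioo ((m : ℝ) * τ) ((m + 1) * τ)) ≤
      volume.restrict (Set.Ioo 0 T) := fun m hm => by
    have : (m : ℝ) ≤ N := by exact_mod_cast hm
    refine Measure.restrict_mono (Set.Ioo_subset_Ioo (by positivity) ?_) le_rfl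
    rw [← hNτ]
    gcongr
  have hf' := fun m hm => hf.mono_measure (Measure.prod_mono (hI m hm) le_rfl)
  have hg' := fun m hm E hE =>
    hg.mono_measure (Measure.prod_mono (hI m hm) (M.restrict_cell_le hΩ (E := E) hE))
  choose! a ha b hb hU using hsol.1
  have h := nodal_bound hΩ hτ hNτ hν hδ hU₀ hsol ha hb hU hf' hg' hn
  rw [mul_assoc]
  exact normLinfL2_sq_le hΩ (ha n hn).1 (hb n hn).1 (hU n hn) h.1 h.2
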